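/- For $\nu,m\in\mathbb C$ and real $t>0$, $t\ne1$, let $P_\nu^{m}(t)$ denote the Ferrers function of the first kind (for $t<1$), respectively the associated Legendre function of the first kind (for $t>1$); with $m=-\mu$, $$P_\nu^{-\mu}(t)=\Big|\frac{1-t}{1+t}\Big|^{\mu/2}\frac{F\big(-\nu,\nu+1;1+\mu;\frac{1-t}{2}\big)}{\Gamma(1+\mu)}=\frac{2^{-\nu}\,|1-t|^{\mu/2}}{(1+t)^{\mu/2-\nu}}\,\frac{F\big(-\nu,\mu-\nu;1+\mu;\frac{t-1}{t+1}\big)}{\Gamma(1+\mu)},$$ where $F/\Gamma(1+\mu)$ is the Gauss hypergeometric function divided by $\Gamma(1+\mu)$, understood as an entire function of the parameters. Let $(a)_n=a(a+1)\cdots(a+n-1)$, and let $\mathcal G_n(\tau,\rho,w)$ and $\widehat{\mathcal G}_n(\tau,\rho,\eta)=i^n\mathcal G_n(\tau,\rho,i\eta)$ be defined by the generating functions $$(1-wz)^{\tau}\Big(1+\frac zw\Big)^{-\tau}(1+z^2)^{-\rho}=\sum_{n=0}^\infty \mathcal G_n(\tau,\rho,w)z^n,\qquad (1+\eta\zeta)^{\tau}\Big(1+\frac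 \zeta\eta\Big)^{-\tau}(1-\zeta^2)^{-\rho}=\sum_{n=0}^\infty \widehat{\mathcal G}_n(\tau,\rho,\eta)\zeta^n .$$ Theorem. Let $x\in(0,1)$, $\mu,\nu\in\mathbb C$ and $w=\sqrt{\frac{1-x}{1+x}}$. All series below are understood as limits of their partial sums, and $1/\Gamma$ is $0$ at the poles of $\Gamma$. (1) One has $$\frac{P_\nu^{-\mu}(1/x)}{\sqrt\pi\,2^{\nu-\mu}x^{-\nu}}=\sum_{n=0}^\infty\frac{(\mu-\nu)_n\,\mathcal G_n(\nu,\nu,w)}{2^n\,\Gamma\big(\frac{n+\mu-\nu+1}{2}\big)}\Big(\frac{1-x}{1+x}\Big)^{\frac{n+\mu-\nu}{4}}P_\nu^{-\frac{\mu+\nu+n}{2}}(x),$$ and, if $\operatorname{Re}\nu>-1$ or $\nu-\mu\in\mathbb N_0$, $$\Big(\frac{1-x}{1+x}\Big)^{\frac{\mu-\nu}{4}}\frac{P_\nu^{-\frac{\mu+\nu}{2}}(x)}{\Gamma\big(\frac{\mu-\nu+1}{2}\big)}=\sum_{n=0}^\infty\frac{(\mu-\nu)_n\,\mathcal G_n(-\nu,-\nu,w)}{\sqrt\pi\,2^{\nu-\mu}x^{-\nu}}P_\nu^{-\mu-n}(1/x).$$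 (2) One has $$\frac{P_\nu^{-\mu}(x)}{\sqrt\pi\,2^{\nu-\mu}x^{\nu}}=\sum_{n=0}^\infty\frac{(\mu-\nu)_n\,\widehat{\mathcal G}_n(\nu,\nu,w)}{2^n\,\Gamma\big(\frac{n+\mu-\nu+1}{2}\big)}\Big(\frac{1-x}{1+x}\Big)^{\frac{n+\mu-\nu}{4}}P_\nu^{-\frac{\mu+\nu+n}{2}}(1/x),$$ and, if $\operatorname{Re}\nu>-1$ or $\nu-\mu\in\mathbb N_0$, $$\Big(\frac{1-x}{1+x}\Big)^{\frac{\mu-\nu}{4}}\frac{P_\nu^{-\frac{\mu+\nu}{2}}(1/x)}{\Gamma\big(\frac{\mu-\nu+1}{2}\big)}=\sum_{n=0}^\infty\frac{(\mu-\nu)_n\,\widehat{\mathcal G}_n(-\nu,-\nu,w)}{\sqrt\pi\,2^{\nu-\mu}x^{\nu}}P_\nu^{-\mu-n}(x).$$ The two relations of each pair are mutually inverse: with $a_n(s)=(s-\nu)_n\,2^{-n}\mathcal G_n(\nu,\nu,w)$ and $b_n(s)=(s-\nu)_n\,2^{-n}\mathcal G_n(-\nu,-\nu,w)$, the pair (1)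 has the form $f(\mu)=\sum_n a_n(\mu)h(\mu+n)$, $h(\mu)=\sum_n b_n(\mu)f(\mu+n)$, where $f(\mu)$ and $h(\mu)$ are the left-hand sides, and for all $s\in\mathbb C$, $n\in\mathbb N_0$, $$\sum_{k=0}^n a_k(s)\,b_{n-k}(s+k)=\sum_{k=0}^n b_k(s)\,a_{n-k}(s+k)=\delta_{n,0};$$ the same holds for the pair (2) with $\widehat{\mathcal G}_n$ in place of $\mathcal G_n$. -/

import Mathlib

open Filter Topology

noncomputable section

/-- The Pochhammer symbol `(a)_n = a (a + 1) ⋯ (a + n - 1)`. -/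
def poch (a : ℂ) (n : ℕ) : ℂ := (ascPochhammer ℂ n).eval a

/-- The regularized Gauss hypergeometric function `F(a, b; c; z) / Γ(c)`, as the sum of its power
series on the unit disc. It is entire in `a`, `b`, `c`: since `Complex.Gamma` is `0` at the poles
of `Γ`, the terms for which `c + n` is a pole vanish, as they should. -/
def regF (a b c z : ℂ) : ℂ :=
  ∑' n : ℕ, poch a n * poch b n / (Complex.Gamma (c + n) * (n.factorial : ℂ)) * z ^ n

/-- The function `P_ν^m(x)` of degree `ν` and order `m`, for real `x > 0`: the Ferrers function of
the first kind if `0 < x < 1`, the associated Legendre function of the first kind if `x > 1`.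
With `m = -μ` this is
`2^{-ν} |1 - x|^{μ/2} (1 + x)^{ν - μ/2} F(-ν, μ - ν; 1 + μ; (x - 1)/(x + 1)) / Γ(1 + μ)`,
the Pfaff transform of `|(1 - x)/(1 + x)|^{μ/2} F(-ν, ν + 1; 1 + μ; (1 - x)/2) / Γ(1 + μ)`;
here the argument of `F` lies in `(-1, 1)` for every `x > 0`. -/
def legendreP (ν m : ℂ) (x : ℝ) : ℂ :=
  2 ^ (-ν) * ((|1 - x| : ℝ) : ℂ) ^ (-m / 2) * ((1 + x : ℝ) : ℂ) ^ (ν + m / 2) *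
    regF (-ν) (-m - ν) (1 - m) (((x - 1) / (x + 1) : ℝ) : ℂ)

/-- The power series of `(1 - c z)^{-a}` in `z`. -/
def binomPS (a c : ℂ) : PowerSeries ℂ :=
  PowerSeries.mk fun k => poch a k / (k.factorial : ℂ) * c ^ k

/-- The power series of `(1 + z²)^{-ρ}` in `z`. -/
def binomSqPS (ρ : ℂ) : PowerSeries ℂ :=
  PowerSeries.mk fun k =>
    if Even k then poch ρ (k / 2) / ((k / 2).factorial : ℂ) * (-1) ^ (k / 2) else 0

/-- `𝒢_n(τ, ρ, w)`: the coefficient of `z^n` in `(1 - w z)^τ (1 + z / w)^{-τ} (1 + z²)^{-ρ}`. -/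
def polyG (n : ℕ) (τ ρ w : ℂ) : ℂ :=
  PowerSeries.coeff n (binomPS (-τ) w * binomPS τ (-w⁻¹) * binomSqPS ρ)

/-- `𝒢̂_n(τ, ρ, η) = i^n 𝒢_n(τ, ρ, i η)`: the coefficient of `ζ^n` in
`(1 + η ζ)^τ (1 + ζ / η)^{-τ} (1 - ζ²)^{-ρ}`. -/
def polyGhat (n : ℕ) (τ ρ η : ℂ) : ℂ :=
  Complex.I ^ n * polyG n τ ρ (Complex.I * η)

/-- The series `∑_{n ≥ 0} f n` converges (as the limit of its partial sums, possibly only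
conditionally) and its sum is `s`. -/
def SeriesSum (f : ℕ → ℂ) (s : ℂ) : Prop :=
  Tendsto (fun N : ℕ => ∑ n ∈ Finset.range N, f n) atTop (𝓝 s)

/-- The coefficient families of two series `F(μ) = ∑ a μ n * H(μ + n)` and
`H(μ) = ∑ b μ n * F(μ + n)` are inverse to each other: substituting either series in the other and
collecting the terms with the same shift leaves the identity. -/
def MutuallyInverse (a b : ℂ → ℕ → ℂ) : Prop :=
  ∀ (μ : ℂ) (n : ℕ),
    (∑ k ∈ Finset.range (n + 1), a μ k * b (μ + k) (n - k)) = (if n = 0 then 1 else 0) ∧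
    (∑ k ∈ Finset.range (n + 1), b μ k * a (μ + k) (n - k)) = (if n = 0 then 1 else 0)

/-- Away from the poles of `Γ`, `regF` is Gauss's function divided by `Γ(c)`. -/
theorem regF_eq (a b c z : ℂ) (hc : ∀ n : ℕ, c ≠ -n) :
    regF a b c z = ordinaryHypergeometric a b c z / Complex.Gamma c := by
  have hG : ∀ n : ℕ, Complex.Gamma (c + n) = Complex.Gamma c * poch c n := by
    intro n
    induction n with
    | zero => simp [poch]
    | succ n ih =>
      have h : c + n ≠ 0 := fun h => hc n (eq_neg_of_add_eq_zero_left h)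
      have h1 := Complex.Gamma_add_one (c + n) h
      simp only [poch, ascPochhammer_succ_eval] at ih ⊢
      push_cast
      rw [← add_assoc, h1, ih]
      ring
  rw [ordinaryHypergeometric_eq_tsum, regF, ← tsum_div_const]
  refine tsum_congr fun n => ?_
  rw [hG n]
  simp only [poch, smul_eq_mul, div_eq_mul_inv, mul_inv]
  ring

/-- The binomial series. -/
theorem hasSum_binomPS (a u : ℂ) (hu : ‖u‖ < 1) :
    HasSum (fun k : ℕ => poch a k / (k.factorial : ℂ) * u ^ k) ((1 - u) ^ (-a)) := by
  have h := (Complex.one_div_one_sub_cpow_hasFPowerSeriesOnBall_zero a).hasSum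
    (y := u) (by simpa [← ofReal_norm, ← ENNReal.ofReal_one] using hu)
  simp only [zero_add, one_div, ← Complex.cpow_neg] at h
  have e : ∀ k : ℕ, poch a k / (k.factorial : ℂ) = Ring.choose (a + k - 1) k := by
    intro k
    have h1 := Ring.factorial_nsmul_multichoose_eq_ascPochhammer a k
    rw [Polynomial.ascPochhammer_smeval_eq_eval, Ring.multichoose_eq, nsmul_eq_mul] at h1
    have h2 : (k.factorial : ℂ) ≠ 0 := by exact_mod_cast k.factorial_ne_zero
    rw [poch, ← h1]
    field_simp
  simp only [FormalMultilinearSeries.ofScalars_apply_eq, smul_eq_mul, ← e] at h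
  exact h

/-- Values of power series multiply. -/
theorem hasSum_coeff_mul (p q : PowerSeries ℂ) (z s t : ℂ)
    (hp : HasSum (fun n => PowerSeries.coeff n p * z ^ n) s)
    (hq : HasSum (fun n => PowerSeries.coeff n q * z ^ n) t) :
    HasSum (fun n => PowerSeries.coeff n (p * q) * z ^ n) (s * t) := by
  have e : ∀ n, PowerSeries.coeff n (p * q) * z ^ n =
      ∑ kl ∈ Finset.HasAntidiagonal.antidiagonal n,
        (PowerSeries.coeff kl.1 p * z ^ kl.1) * (PowerSeries.coeff kl.2 q * z ^ kl.2) := by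
    intro n
    rw [PowerSeries.coeff_mul, Finset.sum_mul]
    refine Finset.sum_congr rfl fun kl hkl => ?_
    rw [← Finset.HasAntidiagonal.mem_antidiagonal.mp hkl, pow_add]
    ring
  have hs := (summable_norm_sum_mul_antidiagonal_of_summable_norm
    hp.summable.norm hq.summable.norm).of_norm
  have ht := tsum_mul_tsum_eq_tsum_sum_antidiagonal_of_summable_norm
    hp.summable.norm hq.summable.norm
  rw [hp.tsum_eq, hq.tsum_eq] at ht
  rw [funext e, ht]
  exact hs.hasSum

/-- The generating function of the `𝒢_n`. -/
theorem hasSum_polyG (τ ρ w z : ℂ) (hw : w ≠ 0) (hw1 : ‖w‖ < 1) (hz : ‖z‖ < ‖w‖) :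
    HasSum (fun n => polyG n τ ρ w * z ^ n)
      ((1 - w * z) ^ τ * (1 + z / w) ^ (-τ) * (1 + z ^ 2) ^ (-ρ)) := by
  have hz1 : ‖z‖ < 1 := hz.trans hw1
  have hz0 := norm_nonneg z
  have hw0 : 0 < ‖w‖ := norm_pos_iff.mpr hw
  have h1 : HasSum (fun n => PowerSeries.coeff n (binomPS (-τ) w) * z ^ n) ((1 - w * z) ^ τ) := by
    have h := hasSum_binomPS (-τ) (w * z) (by rw [norm_mul]; nlinarith)
    rw [neg_neg] at h
    convert h using 1
    funext k
    rw [binomPS, PowerSeries.coeff_mk, mul_pow, mul_assoc]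
  have h2 : HasSum (fun n => PowerSeries.coeff n (binomPS τ (-w⁻¹)) * z ^ n)
      ((1 + z / w) ^ (-τ)) := by
    have h := hasSum_binomPS τ (-w⁻¹ * z) (by
      rw [norm_mul, norm_neg, norm_inv, inv_mul_lt_iff₀ hw0]; simpa using hz)
    rw [show 1 - -w⁻¹ * z = 1 + z / w by rw [div_eq_mul_inv]; ring] at h
    convert h using 1
    funext k
    rw [binomPS, PowerSeries.coeff_mk, mul_pow, mul_assoc]
  have h3 : HasSum (fun n => PowerSeries.coeff n (binomSqPS ρ) * z ^ n)
      ((1 + z ^ 2) ^ (-ρ)) := by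
    have h := hasSum_binomPS ρ (-z ^ 2) (by rw [norm_neg, norm_pow]; nlinarith)
    rw [sub_neg_eq_add] at h
    have hinj : Function.Injective (fun k : ℕ => 2 * k) := fun a b hab => by
      simpa using hab
    refine (hinj.hasSum_iff ?_).mp ?_
    · intro n hn
      have : ¬ Even n := fun ⟨k, hk⟩ => hn ⟨k, by simp only; omega⟩
      simp [binomSqPS, this]
    · convert h using 1
      funext k
      simp only [Function.comp, binomSqPS, PowerSeries.coeff_mk, even_two_mul, if_true]
      rw [Nat.mul_div_cancel_left k two_pos, neg_pow, pow_mul]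
      ring
  exact hasSum_coeff_mul _ _ _ _ _ (hasSum_coeff_mul _ _ _ _ _ h1 h2) h3

/-- The generating function of the `𝒢̂_n`. -/
theorem hasSum_polyGhat (τ ρ η ζ : ℂ) (hη : η ≠ 0) (hη1 : ‖η‖ < 1) (hζ : ‖ζ‖ < ‖η‖) :
    HasSum (fun n => polyGhat n τ ρ η * ζ ^ n)
      ((1 + η * ζ) ^ τ * (1 + ζ / η) ^ (-τ) * (1 - ζ ^ 2) ^ (-ρ)) := by
  have h := hasSum_polyG τ ρ (Complex.I * η) (Complex.I * ζ)
    (mul_ne_zero Complex.I_ne_zero hη) (by simpa using hη1) (by simpa using hζ)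
  rw [mul_div_mul_left _ _ Complex.I_ne_zero, mul_pow, Complex.I_sq,
    show 1 - Complex.I * η * (Complex.I * ζ) = 1 - Complex.I ^ 2 * (η * ζ) by ring,
    Complex.I_sq, neg_one_mul, neg_one_mul, sub_neg_eq_add, ← sub_eq_add_neg] at h
  convert h using 1
  funext k
  rw [polyGhat, mul_pow]
  ring

end

noncomputable section

theorem poch_zero (a : ℂ) : poch a 0 = 1 := by simp [poch]

theorem poch_succ (a : ℂ) (n : ℕ) : poch a (n + 1) = poch a n * (a + n) := by
  simp [poch, ascPochhammer_succ_eval]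

theorem poch_add (a : ℂ) (k n : ℕ) : poch a (k + n) = poch a k * poch (a + k) n := by
  induction n with
  | zero => simp [poch_zero]
  | succ n ih => rw [← add_assoc, poch_succ, poch_succ, ih]; push_cast; ring

theorem poch_one (a : ℂ) : poch a 1 = a := by
  rw [← zero_add 1, poch_succ, poch_zero]; simp

theorem poch_succ_left (a : ℂ) (n : ℕ) : poch a (n + 1) = a * poch (a + 1) n := by
  rw [add_comm, poch_add, poch_one]; simp

theorem poch_two_mul (a : ℂ) (n : ℕ) :
    poch a (2 * n) = 4 ^ n * (poch (a / 2) n * poch ((a + 1) / 2) n) := by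
  induction n with
  | zero => simp [poch_zero]
  | succ n ih =>
    rw [show 2 * (n + 1) = 2 * n + 1 + 1 by ring, poch_succ, poch_succ, ih, poch_succ, poch_succ]
    push_cast
    ring

theorem poch_neg_eq_zero {k n : ℕ} (h : k < n) : poch (-(k : ℂ)) n = 0 := by
  obtain ⟨j, rfl⟩ := Nat.exists_eq_add_of_lt h
  rw [add_assoc, add_comm j, ← add_assoc, poch_add, poch_succ]
  simp

theorem prod_range_eq_poch (a : ℂ) (n : ℕ) : ∏ j ∈ Finset.range n, (a + j) = poch a n := by
  induction n with
  | zero => simp [poch_zero]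
  | succ n ih => rw [Finset.prod_range_succ, ih, poch_succ]

theorem inv_Gamma_eq (c : ℂ) : (Complex.Gamma c)⁻¹ = c * (Complex.Gamma (c + 1))⁻¹ :=
  Complex.one_div_Gamma_eq_self_mul_one_div_Gamma_add_one c

theorem poch_mul_inv_Gamma (a : ℂ) (n : ℕ) :
    poch a n * (Complex.Gamma (a + n))⁻¹ = (Complex.Gamma a)⁻¹ := by
  induction n with
  | zero => simp [poch_zero]
  | succ n ih =>
    rw [← ih, inv_Gamma_eq (a + n), poch_succ]
    push_cast
    rw [add_assoc a]
    ring

theorem isBigO_poch_div_factorial (a : ℂ) :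
    (fun n : ℕ => poch a (n + 1) / (n.factorial : ℂ)) =O[atTop] fun n : ℕ => (n : ℝ) ^ a.re := by
  by_cases ha : Complex.Gamma a = 0
  · obtain ⟨k, rfl⟩ := (Complex.Gamma_eq_zero_iff a).mp ha
    refine (Asymptotics.isBigO_zero _ _).congr' ?_ EventuallyEq.rfl
    filter_upwards [eventually_ge_atTop k] with n hn
    rw [poch_neg_eq_zero (by omega), zero_div]
  · have h := ((Complex.GammaSeq_tendsto_Gamma a).inv₀ ha).isBigO_one ℝ
    have h2 : (fun n : ℕ => (n : ℂ) ^ a) =O[atTop] fun n : ℕ => (n : ℝ) ^ a.re := by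
      refine Asymptotics.IsBigO.of_bound 1 ?_
      filter_upwards [eventually_gt_atTop 0] with n hn
      rw [Complex.norm_natCast_cpow_of_pos hn, one_mul, Real.norm_of_nonneg (by positivity)]
    refine (h.mul h2).congr' ?_ (by simp)
    filter_upwards [eventually_gt_atTop 0] with n hn
    have hn' : (n : ℂ) ^ a ≠ 0 := by
      rw [Ne, Complex.cpow_eq_zero_iff]; simp; omega
    have hf : (n.factorial : ℂ) ≠ 0 := by exact_mod_cast n.factorial_ne_zero
    rw [Complex.GammaSeq, prod_range_eq_poch]
    field_simp

theorem isBigO_factorial_div_poch (b : ℂ) :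
    (fun n : ℕ => (n.factorial : ℂ) / poch b (n + 1)) =O[atTop] fun n : ℕ => (n : ℝ) ^ (-b.re) := by
  have h := (Complex.GammaSeq_tendsto_Gamma b).isBigO_one ℝ
  have h2 : (fun n : ℕ => (n : ℂ) ^ (-b)) =O[atTop] fun n : ℕ => (n : ℝ) ^ (-b.re) := by
    refine Asymptotics.IsBigO.of_bound 1 ?_
    filter_upwards [eventually_gt_atTop 0] with n hn
    rw [Complex.norm_natCast_cpow_of_pos hn, one_mul, Real.norm_of_nonneg (by positivity)]
    simp
  refine (h.mul h2).congr' ?_ (by simp)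
  filter_upwards [eventually_gt_atTop 0] with n hn
  have hn' : (n : ℂ) ^ b ≠ 0 := by
    rw [Ne, Complex.cpow_eq_zero_iff]; simp; omega
  rw [Complex.GammaSeq, prod_range_eq_poch, Complex.cpow_neg]
  field_simp

theorem isBigO_nat_rpow_add_two (r : ℝ) :
    (fun n : ℕ => (n : ℝ) ^ r) =O[atTop] fun n : ℕ => ((n : ℝ) + 2) ^ r := by
  have h : Tendsto (fun n : ℕ => ((n : ℝ) / (n + 2)) ^ r) atTop (𝓝 (1 ^ r)) :=
    (tendsto_natCast_div_add_atTop (2 : ℝ)).rpow_const (Or.inl one_ne_zero)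
  refine ((h.isBigO_one ℝ).mul (Asymptotics.isBigO_refl
    (fun n : ℕ => ((n : ℝ) + 2) ^ r) atTop)).congr' ?_ (by simp)
  refine Eventually.of_forall fun n => ?_
  have : (0 : ℝ) < ((n : ℝ) + 2) ^ r := by positivity
  simp only
  rw [Real.div_rpow (by positivity) (by positivity), div_mul_cancel₀ _ this.ne']

/-- The growth of a quotient `Γ(a + n) / Γ(b + n)`. -/
theorem exists_norm_poch_mul_inv_Gamma_le (a b : ℂ) :
    ∃ C : ℝ, ∀ n : ℕ, ‖poch a n * (Complex.Gamma (b + n))⁻¹‖ ≤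
      C * ((n : ℝ) + 1) ^ (a.re - b.re) := by
  have key : ∀ b : ℂ, Complex.Gamma b ≠ 0 → ∃ C : ℝ, ∀ n : ℕ,
      ‖poch a n * (Complex.Gamma (b + n))⁻¹‖ ≤ C * ((n : ℝ) + 1) ^ (a.re - b.re) := by
    intro b hb
    have h := (isBigO_poch_div_factorial a).mul (isBigO_factorial_div_poch b)
    have h1 : (fun n : ℕ => poch a (n + 1) / poch b (n + 1)) =O[atTop]
        fun n : ℕ => ((n : ℝ) + 2) ^ (a.re - b.re) := by
      refine (h.congr' ?_ ?_).trans (isBigO_nat_rpow_add_two _)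
      · refine Eventually.of_forall fun n => ?_
        have hf : (n.factorial : ℂ) ≠ 0 := by exact_mod_cast n.factorial_ne_zero
        simp only
        field_simp
      · filter_upwards [eventually_gt_atTop 0] with n hn
        rw [← Real.rpow_add (by exact_mod_cast hn), sub_eq_add_neg]
    have h2 : (fun n : ℕ => poch a n / poch b n) =O[atTop]
        fun n : ℕ => ((n : ℝ) + 1) ^ (a.re - b.re) := by
      have := h1.comp_tendsto (tendsto_sub_atTop_nat 1)
      refine this.congr' ?_ ?_ <;> filter_upwards [eventually_gt_atTop 0] with n hn <;>
        obtain ⟨m, rfl⟩ := Nat.exists_eq_succ_of_ne_zero hn.ne'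
      · simp
      · simp only [Function.comp, Nat.succ_sub_one, Nat.succ_eq_add_one]
        push_cast
        norm_num [add_assoc]
    have h3 : (fun n : ℕ => poch a n * (Complex.Gamma (b + n))⁻¹) =O[atTop]
        fun n : ℕ => ((n : ℝ) + 1) ^ (a.re - b.re) := by
      refine (h2.const_mul_left (Complex.Gamma b)⁻¹).congr' ?_ EventuallyEq.rfl
      refine Eventually.of_forall fun n => ?_
      simp only
      have hp : poch b n ≠ 0 := by
        intro h0
        have := poch_mul_inv_Gamma b n
        rw [h0, zero_mul] at this
        exact hb (inv_eq_zero.mp this.symm)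
      rw [← poch_mul_inv_Gamma b n]
      field_simp
    obtain ⟨C, hC⟩ := (Asymptotics.isBigO_nat_atTop_iff (fun n hn => absurd hn
      (by positivity))).mp h3
    refine ⟨C, fun n => (hC n).trans_eq ?_⟩
    rw [Real.norm_of_nonneg (by positivity)]
  have ind : ∀ k : ℕ, ∀ b : ℂ, 0 < b.re + k → ∃ C : ℝ, ∀ n : ℕ,
      ‖poch a n * (Complex.Gamma (b + n))⁻¹‖ ≤ C * ((n : ℝ) + 1) ^ (a.re - b.re) := by
    intro k
    induction k with
    | zero => exact fun b hb => key b (Complex.Gamma_ne_zero_of_re_pos (by simpa using hb))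
    | succ k ih =>
      intro b hb
      obtain ⟨C, hC⟩ := ih (b + 1) (by push_cast at hb; simp; linarith)
      refine ⟨(‖b‖ + 1) * C, fun n => ?_⟩
      have hn : (0 : ℝ) < (n : ℝ) + 1 := by positivity
      rw [inv_Gamma_eq, show poch a n * ((b + n) * (Complex.Gamma (b + n + 1))⁻¹) =
        (b + n) * (poch a n * (Complex.Gamma (b + 1 + n))⁻¹) by rw [add_right_comm]; ring, norm_mul]
      have h1 : ‖b + n‖ ≤ (‖b‖ + 1) * ((n : ℝ) + 1) := by
        refine (norm_add_le _ _).trans ?_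
        rw [Complex.norm_natCast]
        nlinarith [norm_nonneg b, (Nat.cast_nonneg n : (0 : ℝ) ≤ n)]
      refine (mul_le_mul h1 (hC n) (norm_nonneg _) (by positivity)).trans_eq ?_
      rw [show a.re - b.re = (a.re - (b + 1).re) + 1 by simp; ring, Real.rpow_add_one hn.ne']
      ring
  obtain ⟨k, hk⟩ := exists_nat_gt (-b.re)
  exact ind k b (by linarith)

theorem exists_norm_poch_div_factorial_le (a : ℂ) :
    ∃ C : ℝ, ∀ n : ℕ, ‖poch a n / (n.factorial : ℂ)‖ ≤ C * ((n : ℝ) + 1) ^ (a.re - 1) := by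
  obtain ⟨C, hC⟩ := exists_norm_poch_mul_inv_Gamma_le a 1
  refine ⟨C, fun n => ?_⟩
  have := hC n
  rwa [add_comm (1 : ℂ), Complex.Gamma_nat_eq_factorial, ← div_eq_mul_inv, Complex.one_re] at this

theorem binomPS_eq_rescale (a c : ℂ) :
    binomPS a c = PowerSeries.rescale (-c) (PowerSeries.binomialSeries ℂ (-a)) := by
  ext k
  have h1 := Ring.factorial_nsmul_multichoose_eq_ascPochhammer a k
  rw [Polynomial.ascPochhammer_smeval_eq_eval, Ring.multichoose_eq, nsmul_eq_mul] at h1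
  have h2 : (k.factorial : ℂ) ≠ 0 := by exact_mod_cast k.factorial_ne_zero
  have h3 : ((-1 : ℂ) ^ k) * (-1) ^ k = 1 := by rw [← mul_pow]; simp
  rw [PowerSeries.coeff_rescale, PowerSeries.binomialSeries_coeff, Ring.choose_neg, binomPS,
    PowerSeries.coeff_mk, poch, ← h1, neg_pow, Units.smul_def, zsmul_eq_mul,
    Int.cast_negOnePow_natCast, smul_eq_mul, mul_div_cancel_left₀ _ h2]
  linear_combination (Ring.choose (a + k - 1) k * c ^ k) * (-h3)

theorem binomPS_add (a b c : ℂ) : binomPS (a + b) c = binomPS a c * binomPS b c := by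
  rw [binomPS_eq_rescale, binomPS_eq_rescale, binomPS_eq_rescale, ← map_mul,
    ← PowerSeries.binomialSeries_add, neg_add]

theorem binomPS_zero (c : ℂ) : binomPS 0 c = 1 := by
  rw [binomPS_eq_rescale, neg_zero, PowerSeries.binomialSeries_zero, map_one]

theorem binomPS_mul_neg (a c : ℂ) : binomPS a c * binomPS (-a) c = 1 := by
  rw [← binomPS_add, add_neg_cancel, binomPS_zero]

theorem binomPS_neg_one (c : ℂ) : binomPS (-1) c = 1 - PowerSeries.C c * PowerSeries.X := by
  rw [binomPS_eq_rescale, neg_neg]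
  have := PowerSeries.binomialSeries_nat (R := ℂ) (A := ℂ) 1
  rw [Nat.cast_one, pow_one] at this
  rw [this, map_add, map_one, PowerSeries.rescale_X, map_neg]
  ring

theorem rescale_binomPS (a c w : ℂ) :
    PowerSeries.rescale w (binomPS a c) = binomPS a (w * c) := by
  rw [binomPS_eq_rescale, binomPS_eq_rescale, PowerSeries.rescale_rescale, neg_mul, mul_comm c]

theorem coeff_binomPS (a c : ℂ) (n : ℕ) :
    PowerSeries.coeff n (binomPS a c) = poch a n / (n.factorial : ℂ) * c ^ n :=
  PowerSeries.coeff_mk _ _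

theorem constantCoeff_binomPS (a c : ℂ) : PowerSeries.coeff 0 (binomPS a c) = 1 := by
  simp [coeff_binomPS, poch_zero]

/-- The power series of `(1 + q z²)^{-ρ}` in `z`. -/
def binomSqScaledPS (ρ q : ℂ) : PowerSeries ℂ :=
  PowerSeries.expand 2 two_ne_zero (binomPS ρ (-q))

theorem binomSqScaledPS_mul_neg (ρ q : ℂ) :
    binomSqScaledPS ρ q * binomSqScaledPS (-ρ) q = 1 := by
  rw [binomSqScaledPS, binomSqScaledPS, ← map_mul, binomPS_mul_neg, map_one]

theorem coeff_binomSqScaledPS_two_mul (ρ q : ℂ) (k : ℕ) :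
    PowerSeries.coeff (2 * k) (binomSqScaledPS ρ q) =
      poch ρ k / (k.factorial : ℂ) * (-q) ^ k := by
  rw [binomSqScaledPS, PowerSeries.coeff_expand_mul, coeff_binomPS]

theorem coeff_binomSqScaledPS_of_not_even (ρ q : ℂ) {n : ℕ} (hn : ¬ Even n) :
    PowerSeries.coeff n (binomSqScaledPS ρ q) = 0 := by
  rw [binomSqScaledPS, PowerSeries.coeff_expand_of_not_dvd]
  rwa [← even_iff_two_dvd]

theorem rescale_binomSqPS (ρ w : ℂ) :
    PowerSeries.rescale w (binomSqPS ρ) = binomSqScaledPS ρ (w ^ 2) := by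
  ext n
  rw [PowerSeries.coeff_rescale, binomSqPS, PowerSeries.coeff_mk]
  split_ifs with h
  · obtain ⟨k, rfl⟩ := even_iff_two_dvd.mp h
    rw [coeff_binomSqScaledPS_two_mul, Nat.mul_div_cancel_left k two_pos, neg_pow (w ^ 2), pow_mul]
    ring
  · rw [coeff_binomSqScaledPS_of_not_even ρ _ h, mul_zero]

theorem binomSqPS_mul_neg (ρ : ℂ) : binomSqPS ρ * binomSqPS (-ρ) = 1 := by
  have h : ∀ ρ, binomSqPS ρ = binomSqScaledPS ρ 1 := fun ρ => by
    have := rescale_binomSqPS ρ 1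
    rwa [PowerSeries.rescale_one, RingHom.id_apply, one_pow] at this
  rw [h, h, binomSqScaledPS_mul_neg]

/-- A power series whose coefficients are summable against every power of the index. -/
def RapidlyDecreasing (f : PowerSeries ℂ) : Prop :=
  ∀ D : ℕ, Summable fun n : ℕ => ‖PowerSeries.coeff n f‖ * ((n : ℝ) + 1) ^ D

theorem add_add_one_pow_le (D i j : ℕ) :
    (((i + j : ℕ) : ℝ) + 1) ^ D ≤ ((i : ℝ) + 1) ^ D * ((j : ℝ) + 1) ^ D := by
  rw [← mul_pow]
  gcongr
  push_cast
  nlinarith [(Nat.cast_nonneg i : (0 : ℝ) ≤ i), (Nat.cast_nonneg j : (0 : ℝ) ≤ j),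
    mul_nonneg (Nat.cast_nonneg i : (0 : ℝ) ≤ i) (Nat.cast_nonneg j : (0 : ℝ) ≤ j)]

theorem RapidlyDecreasing.mul {f g : PowerSeries ℂ} (hf : RapidlyDecreasing f)
    (hg : RapidlyDecreasing g) : RapidlyDecreasing (f * g) := by
  intro D
  have hp : Summable fun x : ℕ × ℕ => (‖PowerSeries.coeff x.1 f‖ * ((x.1 : ℝ) + 1) ^ D) *
      (‖PowerSeries.coeff x.2 g‖ * ((x.2 : ℝ) + 1) ^ D) :=
    (hf D).mul_of_nonneg (hg D) (fun n => by simp only [Pi.zero_apply]; positivity)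
      (fun n => by simp only [Pi.zero_apply]; positivity)
  have hs := summable_sum_mul_antidiagonal_of_summable_mul
    (f := fun n : ℕ => ‖PowerSeries.coeff n f‖ * ((n : ℝ) + 1) ^ D)
    (g := fun n : ℕ => ‖PowerSeries.coeff n g‖ * ((n : ℝ) + 1) ^ D) hp
  refine Summable.of_nonneg_of_le (fun n => by positivity) (fun n => ?_) hs
  rw [PowerSeries.coeff_mul]
  refine (mul_le_mul_of_nonneg_right (norm_sum_le _ _) (by positivity)).trans ?_
  rw [Finset.sum_mul]
  refine Finset.sum_le_sum fun kl hkl => ?_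
  rw [← Finset.HasAntidiagonal.mem_antidiagonal.mp hkl, norm_mul]
  refine (mul_le_mul_of_nonneg_left (add_add_one_pow_le D kl.1 kl.2) (by positivity)).trans_eq ?_
  ring

theorem rapidlyDecreasing_binomPS (a : ℂ) {q : ℂ} (hq : ‖q‖ < 1) :
    RapidlyDecreasing (binomPS a q) := by
  intro D
  obtain ⟨C, hC⟩ := exists_norm_poch_div_factorial_le a
  obtain ⟨E, hE⟩ := exists_nat_ge (a.re - 1)
  have h0 : 0 ≤ C := by
    have := (norm_nonneg _).trans (hC 0)
    simpa using this
  have hs := (summable_nat_add_iff 1).mpr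
    (summable_pow_mul_geometric_of_norm_lt_one (E + D) (r := ‖q‖) (by simpa using hq))
  by_cases hq0 : q = 0
  · refine summable_of_ne_finset_zero (s := {0}) fun n hn => ?_
    rw [coeff_binomPS, hq0, zero_pow (by simpa using hn)]
    simp
  have hq1 : 0 < ‖q‖ := norm_pos_iff.mpr hq0
  refine Summable.of_nonneg_of_le (fun n => by positivity) (fun n => ?_)
    (hs.mul_left (C * ‖q‖⁻¹))
  rw [coeff_binomPS, norm_mul, norm_pow]
  have h1 : ‖poch a n / (n.factorial : ℂ)‖ ≤ C * ((n : ℝ) + 1) ^ E := by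
    refine (hC n).trans (mul_le_mul_of_nonneg_left ?_ h0)
    rw [← Real.rpow_natCast]
    exact Real.rpow_le_rpow_of_exponent_le (by simp) hE
  calc _ ≤ C * ((n : ℝ) + 1) ^ E * ‖q‖ ^ n * ((n : ℝ) + 1) ^ D := by gcongr
    _ = _ := by
      rw [pow_succ, pow_add]
      push_cast
      field_simp

theorem rapidlyDecreasing_binomSqScaledPS (ρ : ℂ) {q : ℂ} (hq : ‖q‖ < 1) :
    RapidlyDecreasing (binomSqScaledPS ρ q) := by
  intro D
  have hinj : Function.Injective (fun k : ℕ => 2 * k) := fun a b hab => by simpa using hab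
  refine (hinj.summable_iff ?_).mp ?_
  · intro n hn
    rw [coeff_binomSqScaledPS_of_not_even, norm_zero, zero_mul]
    rintro ⟨k, hk⟩
    exact hn ⟨k, by simp only; omega⟩
  · have h := rapidlyDecreasing_binomPS ρ (q := -q) (by simpa using hq) D
    refine Summable.of_nonneg_of_le (fun n => by simp only [Function.comp]; positivity)
      (fun n => ?_) (h.mul_left (2 ^ D))
    simp only [Function.comp, coeff_binomSqScaledPS_two_mul, coeff_binomPS]
    rw [mul_left_comm, ← mul_pow]
    gcongr
    push_cast
    linarith

section Convolution

variable {m K : ℕ → ℂ} {P G g : PowerSeries ℂ} {C : ℝ} {D : ℕ}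

/-- Multiplication by a rapidly decreasing power series preserves convergence and uniform bounds
of sums against the shifts of a sequence. -/
theorem seriesSum_coeff_mul_shift
    (hP : ∀ k, SeriesSum (fun n => PowerSeries.coeff n P * m (n + k)) (K k))
    (hC : ∀ k N, ‖∑ n ∈ Finset.range N, PowerSeries.coeff n P * m (n + k)‖ ≤ C * ((k : ℝ) + 1) ^ D)
    (hG : RapidlyDecreasing G) :
    (∀ k, SeriesSum (fun n => PowerSeries.coeff n (P * G) * m (n + k))
      (∑' j, PowerSeries.coeff j G * K (j + k))) ∧
    ∃ C' : ℝ, ∀ k N, ‖∑ n ∈ Finset.range N, PowerSeries.coeff n (P * G) * m (n + k)‖ ≤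
      C' * ((k : ℝ) + 1) ^ D := by
  have hC0 : 0 ≤ C := by simpa using hC 0 0
  have key : ∀ k N, ∑ n ∈ Finset.range N, PowerSeries.coeff n (P * G) * m (n + k) =
      ∑' j, PowerSeries.coeff j G *
        ∑ i ∈ Finset.range (N - j), PowerSeries.coeff i P * m (i + (j + k)) := by
    intro k N
    rw [tsum_eq_sum (s := Finset.range N)]
    · simp_rw [Finset.mul_sum]
      rw [← Finset.sum_range_diag_flip N fun j i =>
        PowerSeries.coeff j G * (PowerSeries.coeff i P * m (i + (j + k)))]
      refine Finset.sum_congr rfl fun n _ => ?_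
      rw [mul_comm P G, PowerSeries.coeff_mul, Finset.Nat.sum_antidiagonal_eq_sum_range_succ_mk,
        Finset.sum_mul]
      refine Finset.sum_congr rfl fun j hj => ?_
      rw [show n - j + (j + k) = n + k by have := Finset.mem_range.mp hj; omega]
      ring
    · intro j hj
      rw [Nat.sub_eq_zero_of_le (by simpa using hj)]
      simp
  have bd : ∀ k N j, ‖PowerSeries.coeff j G *
      ∑ i ∈ Finset.range (N - j), PowerSeries.coeff i P * m (i + (j + k))‖ ≤
      C * ((k : ℝ) + 1) ^ D * (‖PowerSeries.coeff j G‖ * ((j : ℝ) + 1) ^ D) := by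
    intro k N j
    rw [norm_mul]
    refine (mul_le_mul_of_nonneg_left ((hC (j + k) (N - j)).trans
      (mul_le_mul_of_nonneg_left (add_add_one_pow_le D j k) hC0)) (norm_nonneg _)).trans_eq ?_
    ring
  constructor
  · intro k
    unfold SeriesSum
    simp_rw [key]
    refine tendsto_tsum_of_dominated_convergence ((hG D).mul_left (C * ((k : ℝ) + 1) ^ D))
      (fun j => ?_) (Eventually.of_forall fun N j => bd k N j)
    exact ((hP (j + k)).comp (tendsto_sub_atTop_nat j)).const_mul _
  · refine ⟨C * ∑' j, ‖PowerSeries.coeff j G‖ * ((j : ℝ) + 1) ^ D, fun k N => ?_⟩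
    rw [key]
    refine (tsum_of_norm_bounded ((hG D).mul_left (C * ((k : ℝ) + 1) ^ D)).hasSum
      (bd k N)).trans_eq ?_
    rw [tsum_mul_left]
    ring

theorem tsum_coeff_mul_tsum_coeff_mul_of_summable
    (hF : Summable fun p : ℕ × ℕ =>
      PowerSeries.coeff p.1 g * (PowerSeries.coeff p.2 G * K (p.2 + p.1))) :
    ∑' k, PowerSeries.coeff k g * ∑' j, PowerSeries.coeff j G * K (j + k) =
      ∑' n, PowerSeries.coeff n (g * G) * K n := by
  simp_rw [← tsum_mul_left]
  have hE := Finset.HasAntidiagonal.sigmaAntidiagonalEquivProd.summable_iff.mpr hF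
  rw [← hF.tsum_prod]
  refine (Finset.HasAntidiagonal.sigmaAntidiagonalEquivProd.tsum_eq _).symm.trans
    ((hE.tsum_sigma' fun n => Summable.of_finite).trans ?_)
  refine tsum_congr fun n => ?_
  rw [tsum_fintype, PowerSeries.coeff_mul, Finset.sum_mul]
  refine Eq.trans ?_ (Finset.sum_coe_sort (Finset.HasAntidiagonal.antidiagonal n)
    fun p => PowerSeries.coeff p.1 g * PowerSeries.coeff p.2 G * K n)
  refine Finset.sum_congr rfl fun p _ => ?_
  simp only [Function.comp, Finset.HasAntidiagonal.sigmaAntidiagonalEquivProd_apply]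
  rw [add_comm p.1.2, Finset.HasAntidiagonal.mem_antidiagonal.mp p.2]
  ring

theorem tsum_coeff_mul_tsum_coeff_mul_shift
    (hK : ∀ k, ‖K k‖ ≤ C * ((k : ℝ) + 1) ^ D)
    (hG : RapidlyDecreasing G) (hg : RapidlyDecreasing g) :
    ∑' k, PowerSeries.coeff k g * ∑' j, PowerSeries.coeff j G * K (j + k) =
      ∑' n, PowerSeries.coeff n (g * G) * K n := by
  have hC0 : 0 ≤ C := by have := (norm_nonneg _).trans (hK 0); simpa using this
  refine tsum_coeff_mul_tsum_coeff_mul_of_summable ?_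
  refine Summable.of_norm_bounded (((hg D).mul_of_nonneg (hG D) (fun n => by positivity)
    (fun n => by positivity)).mul_left C) fun p => ?_
  rw [norm_mul, norm_mul]
  refine (mul_le_mul_of_nonneg_left (mul_le_mul_of_nonneg_left ((hK _).trans
    (mul_le_mul_of_nonneg_left (add_add_one_pow_le D p.2 p.1) hC0)) (norm_nonneg _))
    (norm_nonneg _)).trans_eq ?_
  ring

theorem seriesSum_coeff_mul_tsum
    (hP : ∀ k, SeriesSum (fun n => PowerSeries.coeff n P * m (n + k)) (K k))
    (hC : ∀ k N, ‖∑ n ∈ Finset.range N, PowerSeries.coeff n P * m (n + k)‖ ≤ C * ((k : ℝ) + 1) ^ D)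
    (hP0 : PowerSeries.coeff 0 P = 1)
    (hG : RapidlyDecreasing G) (hg : RapidlyDecreasing g) :
    SeriesSum (fun n => PowerSeries.coeff n (P * G) * ∑' k, PowerSeries.coeff k g * m (n + k))
      (∑' n, PowerSeries.coeff n (g * G) * K n) := by
  have hC0 : 0 ≤ C := by simpa using hC 0 0
  have hK : ∀ k, ‖K k‖ ≤ C * ((k : ℝ) + 1) ^ D := fun k =>
    le_of_tendsto (hP k).norm (Eventually.of_forall (hC k))
  have hm : ∀ k, ‖m k‖ ≤ C * ((k : ℝ) + 1) ^ D := fun k => by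
    simpa [hP0] using hC k 1
  obtain ⟨h1, C', h2⟩ := seriesSum_coeff_mul_shift hP hC hG
  rw [← tsum_coeff_mul_tsum_coeff_mul_shift hK hG hg]
  have hs : ∀ n, Summable fun k => PowerSeries.coeff k g * m (n + k) := by
    intro n
    refine Summable.of_norm_bounded ((hg D).mul_left (C * ((n : ℝ) + 1) ^ D)) fun k => ?_
    rw [norm_mul]
    refine (mul_le_mul_of_nonneg_left ((hm _).trans
      (mul_le_mul_of_nonneg_left (add_add_one_pow_le D n k) hC0)) (norm_nonneg _)).trans_eq ?_
    ring
  have key : ∀ N, ∑ n ∈ Finset.range N, PowerSeries.coeff n (P * G) *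
        ∑' k, PowerSeries.coeff k g * m (n + k) =
      ∑' k, PowerSeries.coeff k g *
        ∑ n ∈ Finset.range N, PowerSeries.coeff n (P * G) * m (n + k) := by
    intro N
    simp_rw [← tsum_mul_left, Finset.mul_sum]
    rw [← Summable.tsum_finsetSum fun n _ => (hs n).mul_left _]
    refine tsum_congr fun k => Finset.sum_congr rfl fun n _ => ?_
    ring
  unfold SeriesSum
  simp_rw [key]
  refine tendsto_tsum_of_dominated_convergence ((hg D).mul_left C')
    (fun k => (h1 k).const_mul _) (Eventually.of_forall fun N k => ?_)
  rw [norm_mul]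
  refine (mul_le_mul_of_nonneg_left (h2 k N) (norm_nonneg _)).trans_eq ?_
  ring

end Convolution

theorem coeff_succ_binomPS_sub_one (a c : ℂ) (n : ℕ) :
    PowerSeries.coeff (n + 1) (binomPS (a - 1) c) =
      PowerSeries.coeff (n + 1) (binomPS a c) - c * PowerSeries.coeff n (binomPS a c) := by
  rw [sub_eq_add_neg, binomPS_add, binomPS_neg_one, mul_sub, mul_one, map_sub,
    mul_comm (PowerSeries.C c), ← mul_assoc, PowerSeries.coeff_mul_C, PowerSeries.coeff_succ_mul_X,
    mul_comm c]

theorem coeff_succ_binomPS (a c : ℂ) (n : ℕ) :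
    ((n : ℂ) + 1) * PowerSeries.coeff (n + 1) (binomPS a c) =
      c * (a + n) * PowerSeries.coeff n (binomPS a c) := by
  have h1 : (n.factorial : ℂ) ≠ 0 := by exact_mod_cast n.factorial_ne_zero
  have h2 : ((n : ℂ) + 1) ≠ 0 := by exact_mod_cast n.succ_ne_zero
  rw [coeff_binomPS, coeff_binomPS, poch_succ, Nat.factorial_succ, pow_succ']
  push_cast
  field_simp

theorem exists_norm_coeff_binomPS_le (a : ℂ) :
    ∃ C : ℝ, ∀ n : ℕ, ‖PowerSeries.coeff n (binomPS a (-1))‖ ≤ C * ((n : ℝ) + 1) ^ (a.re - 1) := by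
  obtain ⟨C, hC⟩ := exists_norm_poch_div_factorial_le a
  refine ⟨C, fun n => ?_⟩
  rw [coeff_binomPS, norm_mul, norm_pow, norm_neg, norm_one, one_pow, mul_one]
  exact hC n

/-- `(s)_n / Γ(1 + ν + s + n)`, a regularized moment of the beta distribution. -/
def betaMoment (ν s : ℂ) (n : ℕ) : ℂ :=
  poch s n * (Complex.Gamma (1 + ν + s + n))⁻¹

theorem betaMoment_add (ν s : ℂ) (k n : ℕ) :
    betaMoment ν s (n + k) = poch s k * betaMoment ν (s + k) n := by
  rw [betaMoment, betaMoment, add_comm n k, poch_add, mul_assoc]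
  push_cast
  ring_nf

theorem betaMoment_succ (ν s : ℂ) (n : ℕ) :
    (1 + ν + s + n) * betaMoment ν s (n + 1) = (s + n) * betaMoment ν s n := by
  rw [betaMoment, betaMoment, poch_succ, inv_Gamma_eq (1 + ν + s + n)]
  push_cast
  rw [add_assoc (1 + ν + s)]
  ring

theorem betaMoment_neg_eq_zero (ν : ℂ) {k n : ℕ} (h : k < n) : betaMoment ν (-k) n = 0 := by
  rw [betaMoment, poch_neg_eq_zero h, zero_mul]

theorem exists_norm_betaMoment_le (ν s : ℂ) :
    ∃ C : ℝ, ∀ n : ℕ, ‖betaMoment ν s n‖ ≤ C * ((n : ℝ) + 1) ^ (-ν.re - 1) := by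
  obtain ⟨C, hC⟩ := exists_norm_poch_mul_inv_Gamma_le s (1 + ν + s)
  refine ⟨C, fun n => (hC n).trans_eq ?_⟩
  congr 2
  simp
  ring

theorem sum_binom_mul_betaMoment_telescope (ν s : ℂ) (N : ℕ) :
    s * ∑ n ∈ Finset.range (N + 2), PowerSeries.coeff n (binomPS (-ν) (-1)) * betaMoment ν s n =
      (s + 2 * ν + 2) * ∑ n ∈ Finset.range N,
        PowerSeries.coeff n (binomPS (-ν) (-1)) * betaMoment ν s (n + 2) +
      PowerSeries.coeff (N + 1) (binomPS (-ν - 1) (-1)) *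
        ((s + (N + 1 : ℕ)) * betaMoment ν s (N + 1)) := by
  induction N with
  | zero =>
    have h := betaMoment_succ ν s 0
    simp only [Nat.cast_zero, add_zero, zero_add] at h
    simp only [Finset.sum_range_succ, Finset.sum_range_zero, zero_add,
      coeff_binomPS, poch_one, poch_zero]
    simp
    linear_combination -h
  | succ N ih =>
    rw [Finset.sum_range_succ _ (N + 2), Finset.sum_range_succ _ N, mul_add, ih]
    have h := betaMoment_succ ν s (N + 1)
    have h1 := coeff_succ_binomPS (-ν) (-1) N
    have h2 := coeff_succ_binomPS (-ν) (-1) (N + 1)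
    rw [coeff_succ_binomPS_sub_one, coeff_succ_binomPS_sub_one]
    push_cast at *
    rw [show N + 1 + 1 = N + 2 by ring] at *
    linear_combination -(PowerSeries.coeff (N + 1) (binomPS (-ν) (-1)) +
      PowerSeries.coeff N (binomPS (-ν) (-1))) * h - betaMoment ν s (N + 2) * h2 +
      betaMoment ν s (N + 2) * h1

/-- The sum `√π 2^{-s} / (Γ((s + 1) / 2) Γ(s / 2 + ν + 1))` of Kummer's series. -/
def kummerSum (ν s : ℂ) : ℂ :=
  (√Real.pi : ℝ) * 2 ^ (-s) * (Complex.Gamma ((s + 1) / 2))⁻¹ * (Complex.Gamma (s / 2 + ν + 1))⁻¹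

theorem kummerSum_add_two (ν s : ℂ) :
    (s + 2 * ν + 2) * (s + 1) * kummerSum ν (s + 2) = kummerSum ν s := by
  have h1 := inv_Gamma_eq ((s + 1) / 2)
  have h2 := inv_Gamma_eq (s / 2 + ν + 1)
  have h3 : (2 : ℂ) ^ (-s) = 4 * 2 ^ (-(s + 2)) := by
    rw [neg_add, Complex.cpow_add _ _ two_ne_zero, Complex.cpow_neg _ 2]
    norm_num
    ring
  rw [kummerSum, kummerSum, h1, h2, h3, show (s + 2 + 1) / 2 = (s + 1) / 2 + 1 by ring,
    show (s + 2) / 2 + ν + 1 = s / 2 + ν + 1 + 1 by ring]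
  ring

theorem tendsto_boundary_betaMoment (ν s : ℂ) (h : -1 < ν.re ∨ ∃ k : ℕ, s = -k) :
    Tendsto (fun n : ℕ => PowerSeries.coeff n (binomPS (-ν - 1) (-1)) *
      ((s + n) * betaMoment ν s n)) atTop (𝓝 0) := by
  rcases h with h | ⟨k, rfl⟩
  · obtain ⟨C, hC⟩ := exists_norm_coeff_binomPS_le (-ν - 1)
    obtain ⟨E, hE⟩ := exists_norm_betaMoment_le ν s
    have hlim : Tendsto (fun n : ℕ => C * (‖s‖ + 1) * E * ((n : ℝ) + 1) ^ (-(2 * ν.re + 2)))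
        atTop (𝓝 (C * (‖s‖ + 1) * E * 0)) := by
      refine Tendsto.const_mul _ ?_
      exact (tendsto_rpow_neg_atTop (by linarith)).comp
        (tendsto_atTop_add_const_right _ _ tendsto_natCast_atTop_atTop)
    rw [mul_zero] at hlim
    refine squeeze_zero_norm (fun n => ?_) hlim
    have hn : (0 : ℝ) < (n : ℝ) + 1 := by positivity
    have h1 : ‖s + n‖ ≤ (‖s‖ + 1) * ((n : ℝ) + 1) := by
      refine (norm_add_le _ _).trans ?_
      rw [Complex.norm_natCast]
      nlinarith [norm_nonneg s, (Nat.cast_nonneg n : (0 : ℝ) ≤ n)]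
    rw [norm_mul, norm_mul]
    refine (mul_le_mul (hC n) (mul_le_mul h1 (hE n) (norm_nonneg _) (by positivity))
      (by positivity) ((norm_nonneg _).trans (hC n))).trans_eq ?_
    rw [show -(2 * ν.re + 2) = ((-ν - 1).re - 1) + (-ν.re - 1) + 1 by simp; ring,
      Real.rpow_add_one hn.ne', Real.rpow_add hn]
    ring
  · refine tendsto_const_nhds.congr' ?_
    filter_upwards [eventually_gt_atTop k] with n hn
    rw [betaMoment_neg_eq_zero ν hn]
    simp

theorem seriesSum_kummer_of_add_two (ν s : ℂ) (hs : s ≠ 0)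
    (h : -1 < ν.re ∨ ∃ k : ℕ, s = -k)
    (ih : SeriesSum (fun n => PowerSeries.coeff n (binomPS (-ν) (-1)) * betaMoment ν (s + 2) n)
      (kummerSum ν (s + 2))) :
    SeriesSum (fun n => PowerSeries.coeff n (binomPS (-ν) (-1)) * betaMoment ν s n)
      (kummerSum ν s) := by
  unfold SeriesSum at *
  rw [← tendsto_add_atTop_iff_nat 2]
  have hb := (tendsto_boundary_betaMoment ν s h).comp (tendsto_add_atTop_nat 1)
  have h2 : ∀ n, betaMoment ν s (n + 2) = s * (s + 1) * betaMoment ν (s + 2) n := fun n => by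
    rw [betaMoment_add, poch_succ, poch_one]; simp
  have := ((ih.const_mul ((s + 2 * ν + 2) * (s + 1))).add (hb.const_mul s⁻¹))
  rw [kummerSum_add_two, mul_zero, add_zero] at this
  refine this.congr fun N => ?_
  have ht := sum_binom_mul_betaMoment_telescope ν s N
  have h3 : ∑ n ∈ Finset.range N, PowerSeries.coeff n (binomPS (-ν) (-1)) * betaMoment ν s (n + 2)
      = s * (s + 1) * ∑ n ∈ Finset.range N,
        PowerSeries.coeff n (binomPS (-ν) (-1)) * betaMoment ν (s + 2) n := by
    rw [Finset.mul_sum]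
    exact Finset.sum_congr rfl fun n _ => by rw [h2]; ring
  rw [h3] at ht
  simp only [Function.comp]
  field_simp
  linear_combination -ht

theorem norm_sum_binom_mul_pow_le (ν : ℂ) (h : -1 < ν.re) :
    ∃ C : ℝ, ∀ (N : ℕ) (t : ℝ), 0 ≤ t → t ≤ 1 →
      ‖∑ n ∈ Finset.range N, PowerSeries.coeff n (binomPS (-ν) (-1)) * (t : ℂ) ^ n‖ ≤ C := by
  obtain ⟨C, hC⟩ := exists_norm_coeff_binomPS_le (-ν - 1)
  obtain ⟨E, hE⟩ := exists_norm_coeff_binomPS_le (-ν)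
  have hE0 : 0 ≤ E := by simpa using (norm_nonneg _).trans (hE 0)
  have hs : Summable fun n : ℕ => C * ((n : ℝ) + 1) ^ ((-ν - 1).re - 1) := by
    have := (summable_nat_add_iff 1).mpr
      (Real.summable_nat_rpow (p := (-ν - 1).re - 1) |>.mpr (by simp; linarith))
    exact (this.congr fun n => by push_cast; rfl).mul_left C
  have key : ∀ (N : ℕ) (t : ℂ),
      (1 + t) * ∑ n ∈ Finset.range (N + 1), PowerSeries.coeff n (binomPS (-ν) (-1)) * t ^ n =
        ∑ n ∈ Finset.range (N + 1), PowerSeries.coeff n (binomPS (-ν - 1) (-1)) * t ^ n +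
          PowerSeries.coeff N (binomPS (-ν) (-1)) * t ^ (N + 1) := by
    intro N t
    induction N with
    | zero => simp [coeff_binomPS, poch_zero]
    | succ N ih =>
      rw [Finset.sum_range_succ, mul_add, ih, Finset.sum_range_succ _ (N + 1),
        coeff_succ_binomPS_sub_one]
      ring
  refine ⟨∑' n : ℕ, C * ((n : ℝ) + 1) ^ ((-ν - 1).re - 1) + E, fun N t h0 h1 => ?_⟩
  have hpos : 0 ≤ ∑' n : ℕ, C * ((n : ℝ) + 1) ^ ((-ν - 1).re - 1) :=
    tsum_nonneg fun n => (norm_nonneg _).trans (hC n)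
  have ht : ∀ n : ℕ, ‖(t : ℂ) ^ n‖ ≤ 1 := fun n => by
    rw [norm_pow, Complex.norm_real, Real.norm_of_nonneg h0]
    exact pow_le_one₀ h0 h1
  cases N with
  | zero => simp; positivity
  | succ N =>
    have h2 : (1 : ℝ) ≤ ‖(1 : ℂ) + t‖ := by
      rw [show (1 : ℂ) + t = ((1 + t : ℝ) : ℂ) by push_cast; rfl, Complex.norm_real,
        Real.norm_of_nonneg (by linarith)]
      linarith
    refine (le_mul_of_one_le_left (norm_nonneg _) h2).trans ?_
    rw [← norm_mul, key]
    refine (norm_add_le _ _).trans (add_le_add ?_ ?_)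
    · refine (norm_sum_le _ _).trans ((Finset.sum_le_sum fun n _ => ?_).trans
        (hs.sum_le_tsum _ fun n _ => (norm_nonneg _).trans (hC n)))
      rw [norm_mul]
      exact (mul_le_of_le_one_right (norm_nonneg _) (ht n)).trans (hC n)
    · rw [norm_mul]
      refine (mul_le_of_le_one_right (norm_nonneg _) (ht _)).trans ((hE N).trans ?_)
      refine mul_le_of_le_one_right hE0 (Real.rpow_le_one_of_one_le_of_nonpos (by simp) ?_)
      simp
      linarith

theorem integral_cpow_mul_one_sub_sq_cpow (ν s : ℂ) :
    ∫ t : ℝ in 0..1, (t : ℂ) ^ (s - 1) * ((1 - t ^ 2 : ℝ) : ℂ) ^ ν =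
      1 / 2 * Complex.betaIntegral (s / 2) (ν + 1) := by
  have hm : ∀ (f : ℝ → ℂ) (s : ℂ), mellin ((Set.Iio (1 : ℝ)).indicator f) s =
      ∫ t : ℝ in 0..1, (t : ℂ) ^ (s - 1) * f t := by
    intro f s
    rw [mellin, intervalIntegral.integral_of_le zero_le_one, MeasureTheory.integral_Ioc_eq_integral_Ioo,
      ← Set.Ioi_inter_Iio, ← MeasureTheory.setIntegral_indicator measurableSet_Iio]
    congr 1
    ext t
    simp only [smul_eq_mul, Set.indicator, mul_ite, mul_zero]
  have h := mellin_comp_rpow ((Set.Iio (1 : ℝ)).indicator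
    fun t : ℝ => ((1 - t : ℝ) : ℂ) ^ ν) s 2
  rw [hm] at h
  have h2 : mellin (fun t : ℝ => (Set.Iio (1 : ℝ)).indicator
      (fun t : ℝ => ((1 - t : ℝ) : ℂ) ^ ν) (t ^ (2 : ℝ))) s =
      mellin ((Set.Iio (1 : ℝ)).indicator fun t : ℝ => ((1 - t ^ 2 : ℝ) : ℂ) ^ ν) s := by
    rw [mellin, mellin]
    refine MeasureTheory.setIntegral_congr_fun measurableSet_Ioi fun t ht => ?_
    have ht : (0 : ℝ) < t := ht
    simp only [Set.indicator, Set.mem_Iio, Real.rpow_two]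
    congr 1
    exact if_congr (by rw [sq_lt_one_iff_abs_lt_one, abs_of_pos ht]) rfl rfl
  rw [h2, hm] at h
  rw [h, Complex.betaIntegral]
  simp

theorem seriesSum_kummer_of_re_pos (ν s : ℂ) (hν : -1 < ν.re) (hs : 0 < s.re) :
    SeriesSum (fun n => PowerSeries.coeff n (binomPS (-ν) (-1)) * betaMoment ν s n)
      (kummerSum ν s) := by
  have hν1 : 0 < (ν + 1).re := by simp; linarith
  have hΓs := Complex.Gamma_ne_zero_of_re_pos hs
  have hΓν := Complex.Gamma_ne_zero_of_re_pos hν1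
  have hs2 : 0 < (s / 2).re := by simp; linarith
  obtain ⟨C, hC⟩ := norm_sum_binom_mul_pow_le ν hν
  let w : ℝ → ℂ := fun t => (t : ℂ) ^ (s - 1) * (1 - (t : ℂ)) ^ (ν + 1 - 1)
  have hw : IntervalIntegrable w MeasureTheory.volume 0 1 := Complex.betaIntegral_convergent hs hν1
  have hmom : ∀ n : ℕ, Complex.Gamma s * Complex.Gamma (ν + 1) * betaMoment ν s n =
      ∫ t : ℝ in 0..1, w t * (t : ℂ) ^ n := by
    intro n
    have hsn : 0 < (s + n).re := by simp; positivity
    have h1 := Complex.Gamma_mul_Gamma_eq_betaIntegral hsn hν1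
    have h2 : Complex.Gamma s * poch s n = Complex.Gamma (s + n) := by
      have := poch_mul_inv_Gamma s n
      have h3 := Complex.Gamma_ne_zero_of_re_pos hsn
      field_simp at this
      linear_combination this
    have h4 : Complex.Gamma (s + n + (ν + 1)) ≠ 0 :=
      Complex.Gamma_ne_zero_of_re_pos (by rw [Complex.add_re]; linarith)
    have h5 : Complex.betaIntegral (s + n) (ν + 1) = ∫ t : ℝ in 0..1, w t * (t : ℂ) ^ n := by
      rw [Complex.betaIntegral]
      refine intervalIntegral.integral_congr_ae (Eventually.of_forall fun t ht => ?_)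
      rw [Set.uIoc_of_le zero_le_one] at ht
      have ht0 : (t : ℂ) ≠ 0 := by exact_mod_cast ht.1.ne'
      simp only [w]
      rw [show s + n - 1 = s - 1 + n by ring, Complex.cpow_add _ _ ht0, Complex.cpow_natCast]
      ring
    rw [← h5, betaMoment, show 1 + ν + s + (n : ℂ) = s + n + (ν + 1) by ring,
      show Complex.Gamma s * Complex.Gamma (ν + 1) *
        (poch s n * (Complex.Gamma (s + n + (ν + 1)))⁻¹) =
        (Complex.Gamma s * poch s n) * Complex.Gamma (ν + 1) *
          (Complex.Gamma (s + n + (ν + 1)))⁻¹ by ring, h2, h1]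
    field_simp
  have hint : ∀ n : ℕ, IntervalIntegrable (fun t : ℝ => w t * (t : ℂ) ^ n)
      MeasureTheory.volume 0 1 := fun n =>
    hw.mul_continuousOn (by fun_prop)
  have hsum : ∀ N : ℕ, Complex.Gamma s * Complex.Gamma (ν + 1) *
      ∑ n ∈ Finset.range N, PowerSeries.coeff n (binomPS (-ν) (-1)) * betaMoment ν s n =
      ∫ t : ℝ in 0..1, w t * ∑ n ∈ Finset.range N,
        PowerSeries.coeff n (binomPS (-ν) (-1)) * (t : ℂ) ^ n := by
    intro N
    simp_rw [Finset.mul_sum]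
    rw [intervalIntegral.integral_finsetSum fun n _ =>
      ((hint n).const_mul (PowerSeries.coeff n (binomPS (-ν) (-1)))).congr
        (fun t _ => by ring)]
    refine Finset.sum_congr rfl fun n _ => ?_
    rw [mul_left_comm, hmom, ← intervalIntegral.integral_const_mul]
    refine intervalIntegral.integral_congr fun t _ => ?_
    ring
  have hlim : Tendsto (fun N : ℕ => ∫ t : ℝ in 0..1, w t * ∑ n ∈ Finset.range N,
      PowerSeries.coeff n (binomPS (-ν) (-1)) * (t : ℂ) ^ n) atTop
      (𝓝 (∫ t : ℝ in 0..1, (t : ℂ) ^ (s - 1) * ((1 - t ^ 2 : ℝ) : ℂ) ^ ν)) := by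
    refine intervalIntegral.tendsto_integral_filter_of_dominated_convergence
      (fun t => C * ‖w t‖) (Eventually.of_forall fun N => ?_) (Eventually.of_forall fun N => ?_)
      (hw.norm.const_mul C) ?_
    · exact (hw.mul_continuousOn (g := fun t : ℝ => ∑ n ∈ Finset.range N,
        PowerSeries.coeff n (binomPS (-ν) (-1)) * (t : ℂ) ^ n)
        (by fun_prop)).def'.aestronglyMeasurable
    · refine Eventually.of_forall fun t ht => ?_
      rw [Set.uIoc_of_le zero_le_one] at ht
      rw [norm_mul, mul_comm]
      exact mul_le_mul_of_nonneg_right (hC N t ht.1.le ht.2) (norm_nonneg _)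
    · have h1 : ∀ᵐ t : ℝ, t ≠ 1 := by simp [MeasureTheory.ae_iff]
      filter_upwards [h1] with t ht1 ht
      rw [Set.uIoc_of_le zero_le_one] at ht
      have hlt : t < 1 := lt_of_le_of_ne ht.2 ht1
      have h2 := (hasSum_binomPS (-ν) (-t) (by
        rw [norm_neg, Complex.norm_real, Real.norm_of_nonneg ht.1.le]; exact hlt)).tendsto_sum_nat
      rw [neg_neg, sub_neg_eq_add] at h2
      have h3 : (t : ℂ) ^ (s - 1) * ((1 - t ^ 2 : ℝ) : ℂ) ^ ν = w t * (1 + t) ^ ν := by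
        simp only [w]
        rw [show (1 - t ^ 2 : ℝ) = (1 - t) * (1 + t) by ring, Complex.ofReal_mul,
          Complex.mul_cpow_ofReal_nonneg (by linarith) (by linarith [ht.1])]
        push_cast
        rw [add_sub_cancel_right]
        ring
      rw [h3]
      refine (h2.congr fun N => Finset.sum_congr rfl fun n _ => ?_).const_mul _
      rw [coeff_binomPS, neg_pow (t : ℂ)]
      ring
  simp_rw [← hsum] at hlim
  rw [integral_cpow_mul_one_sub_sq_cpow] at hlim
  have hfin := hlim.const_mul (Complex.Gamma s * Complex.Gamma (ν + 1))⁻¹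
  have hval : (Complex.Gamma s * Complex.Gamma (ν + 1))⁻¹ *
      (1 / 2 * Complex.betaIntegral (s / 2) (ν + 1)) = kummerSum ν s := by
    have h1 := Complex.Gamma_mul_Gamma_eq_betaIntegral hs2 hν1
    have h2 := Complex.Gamma_mul_Gamma_add_half (s / 2)
    rw [mul_div_cancel₀ s two_ne_zero] at h2
    have h3 : Complex.Gamma ((s + 1) / 2) ≠ 0 :=
      Complex.Gamma_ne_zero_of_re_pos (by simp; linarith)
    have h4 : Complex.Gamma (s / 2 + ν + 1) ≠ 0 :=
      Complex.Gamma_ne_zero_of_re_pos (by simp at hs2 ⊢; linarith)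
    rw [show s / 2 + 1 / 2 = (s + 1) / 2 by ring] at h2
    have h5 : (2 : ℂ) ^ (1 - s) = 2 * 2 ^ (-s) := by
      rw [sub_eq_add_neg, Complex.cpow_add _ _ two_ne_zero, Complex.cpow_one]
    rw [h5] at h2
    rw [← add_assoc] at h1
    rw [kummerSum]
    generalize Complex.Gamma (s / 2 + ν + 1) = g at *
    have h6 : Complex.betaIntegral (s / 2) (ν + 1) =
        Complex.Gamma (s / 2) * Complex.Gamma (ν + 1) / g := by
      rw [h1, mul_div_cancel_left₀ _ h4]
    rw [h6]
    field_simp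
    linear_combination h2
  rw [hval] at hfin
  refine hfin.congr fun N => ?_
  rw [inv_mul_cancel_left₀ (mul_ne_zero hΓs hΓν)]

theorem seriesSum_of_eventually_zero {f : ℕ → ℂ} {N : ℕ} (h : ∀ n, N ≤ n → f n = 0) :
    SeriesSum f (∑ n ∈ Finset.range N, f n) :=
  (hasSum_sum_of_ne_finset_zero fun n hn => h n (by simpa using hn)).tendsto_sum_nat

theorem Gamma_one_half : Complex.Gamma (1 / 2) = (√Real.pi : ℝ) := by
  rw [← Real.Gamma_one_half_eq, ← Complex.Gamma_ofReal]
  norm_num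

theorem ofReal_sqrt_pi_ne_zero : ((√Real.pi : ℝ) : ℂ) ≠ 0 := by
  exact_mod_cast (Real.sqrt_pos.mpr Real.pi_pos).ne'

theorem seriesSum_kummer_zero (ν : ℂ) :
    SeriesSum (fun n => PowerSeries.coeff n (binomPS (-ν) (-1)) * betaMoment ν 0 n)
      (kummerSum ν 0) := by
  have h := seriesSum_of_eventually_zero (N := 1)
    (f := fun n => PowerSeries.coeff n (binomPS (-ν) (-1)) * betaMoment ν 0 n) fun n hn => by
      have := betaMoment_neg_eq_zero ν (k := 0) (n := n) (by omega)
      rw [Nat.cast_zero, neg_zero] at this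
      rw [this, mul_zero]
  convert h using 1
  have := ofReal_sqrt_pi_ne_zero
  rw [kummerSum, Finset.sum_range_one, constantCoeff_binomPS, betaMoment, poch_zero]
  simp only [zero_add, Gamma_one_half, neg_zero, Complex.cpow_zero, zero_div, Nat.cast_zero,
    add_zero, one_mul, mul_one]
  rw [mul_inv_cancel₀ this, one_mul, add_comm]

theorem seriesSum_kummer_neg_one (ν : ℂ) :
    SeriesSum (fun n => PowerSeries.coeff n (binomPS (-ν) (-1)) * betaMoment ν (-1) n)
      (kummerSum ν (-1)) := by
  have h := seriesSum_of_eventually_zero (N := 2)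
    (f := fun n => PowerSeries.coeff n (binomPS (-ν) (-1)) * betaMoment ν (-1) n) fun n hn => by
      have := betaMoment_neg_eq_zero ν (k := 1) (n := n) (by omega)
      rw [Nat.cast_one] at this
      rw [this, mul_zero]
  convert h using 1
  have h1 := inv_Gamma_eq ν
  rw [kummerSum, Finset.sum_range_succ, Finset.sum_range_one, constantCoeff_binomPS, betaMoment,
    betaMoment, poch_zero, coeff_binomPS, poch_one, poch_one]
  simp [Complex.Gamma_zero]
  linear_combination -h1

/-- Kummer's summation theorem at `-1`, in regularized form. -/
theorem seriesSum_kummer (ν s : ℂ) (h : -1 < ν.re ∨ ∃ k : ℕ, s = -k) :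
    SeriesSum (fun n => PowerSeries.coeff n (binomPS (-ν) (-1)) * betaMoment ν s n)
      (kummerSum ν s) := by
  rcases h with h | ⟨k, rfl⟩
  · have ind : ∀ p : ℕ, ∀ s : ℂ, 0 < s.re + p →
        SeriesSum (fun n => PowerSeries.coeff n (binomPS (-ν) (-1)) * betaMoment ν s n)
          (kummerSum ν s) := by
      intro p
      induction p with
      | zero => exact fun s hs => seriesSum_kummer_of_re_pos ν s h (by simpa using hs)
      | succ p ih =>
        intro s hs
        by_cases hs0 : s = 0
        · rw [hs0]
          exact seriesSum_kummer_zero ν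
        · refine seriesSum_kummer_of_add_two ν s hs0 (Or.inl h) (ih _ ?_)
          push_cast at hs
          simp
          linarith
    obtain ⟨p, hp⟩ := exists_nat_gt (-s.re)
    exact ind p s (by linarith)
  · induction k using Nat.twoStepInduction with
    | zero => simpa using seriesSum_kummer_zero ν
    | one => simpa using seriesSum_kummer_neg_one ν
    | more k ih _ =>
      refine seriesSum_kummer_of_add_two ν _ ?_ (Or.inr ⟨_, rfl⟩) ?_
      · rw [Ne, neg_eq_zero, Nat.cast_eq_zero]
        omega
      · rw [show -((k + 2 : ℕ) : ℂ) + 2 = -k by push_cast; ring]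
        exact ih

theorem seriesSum_kummer_shift (ν s : ℂ) (h : -1 < ν.re ∨ ∃ k : ℕ, s = -k) (k : ℕ) :
    SeriesSum (fun n => PowerSeries.coeff n (binomPS (-ν) (-1)) * betaMoment ν s (n + k))
      (poch s k * kummerSum ν (s + k)) := by
  simp_rw [betaMoment_add ν s k]
  by_cases hk : poch s k = 0
  · simp [hk, SeriesSum]
  have h' : -1 < ν.re ∨ ∃ j : ℕ, s + k = -j := by
    refine h.imp_right ?_
    rintro ⟨j, rfl⟩
    refine ⟨j - k, ?_⟩
    have hkj : k ≤ j := by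
      by_contra hlt
      exact hk (poch_neg_eq_zero (by omega))
    push_cast [hkj]
    ring
  refine ((seriesSum_kummer ν (s + k) h').const_mul (poch s k)).congr fun N => ?_
  rw [Finset.mul_sum]
  exact Finset.sum_congr rfl fun n _ => by ring

theorem betaMoment_sub_succ (ν s : ℂ) (n : ℕ) :
    betaMoment ν s n - betaMoment ν s (n + 1) = (ν + 1) * betaMoment (ν + 1) s n := by
  rw [betaMoment, betaMoment, betaMoment, poch_succ, inv_Gamma_eq (1 + ν + s + n)]
  push_cast
  rw [show 1 + ν + s + ((n : ℂ) + 1) = 1 + ν + s + n + 1 by ring,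
    show 1 + (ν + 1) + s + (n : ℂ) = 1 + ν + s + n + 1 by ring]
  ring

theorem nonneg_of_norm_le_mul_rpow {f : ℕ → ℂ} {C r : ℝ}
    (h : ∀ n, ‖f n‖ ≤ C * ((n : ℝ) + 1) ^ r) : 0 ≤ C := by
  simpa using (norm_nonneg _).trans (h 0)

theorem summable_natCast_add_one_rpow {r : ℝ} (hr : r < -1) :
    Summable fun n : ℕ => ((n : ℝ) + 1) ^ r :=
  ((summable_nat_add_iff 1).mpr (Real.summable_nat_rpow.mpr hr)).congr fun n => by push_cast; rfl

theorem natCast_add_one_rpow_le_of_nonpos {r : ℝ} (hr : r ≤ 0) (n k : ℕ) :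
    (((n + k : ℕ) : ℝ) + 1) ^ r ≤ ((n : ℝ) + 1) ^ r :=
  Real.rpow_le_rpow_of_nonpos (by positivity) (by push_cast; simp) hr

/-- The partial sums of Kummer's series and its shifts are uniformly bounded. -/
theorem exists_norm_sum_kummer_le (ν s : ℂ) (h : -1 < ν.re ∨ ∃ k : ℕ, s = -k) :
    ∃ C : ℝ, ∀ k N : ℕ, ‖∑ n ∈ Finset.range N,
      PowerSeries.coeff n (binomPS (-ν) (-1)) * betaMoment ν s (n + k)‖ ≤ C := by
  rcases h with h | ⟨j, rfl⟩
  · obtain ⟨A, hA⟩ := exists_norm_coeff_binomPS_le (-ν - 1)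
    obtain ⟨B, hB⟩ := exists_norm_coeff_binomPS_le (-ν)
    obtain ⟨M, hM⟩ := exists_norm_betaMoment_le ν s
    obtain ⟨L, hL⟩ := exists_norm_betaMoment_le (ν + 1) s
    have hA0 := nonneg_of_norm_le_mul_rpow hA
    have hB0 := nonneg_of_norm_le_mul_rpow hB
    have hM0 := nonneg_of_norm_le_mul_rpow hM
    have hL0 := nonneg_of_norm_le_mul_rpow hL
    have hM1 : ∀ n, ‖betaMoment ν s n‖ ≤ M := fun n =>
      (hM n).trans (mul_le_of_le_one_right hM0
        (Real.rpow_le_one_of_one_le_of_nonpos (by simp) (by linarith)))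
    have hB1 : ∀ n, ‖PowerSeries.coeff n (binomPS (-ν) (-1))‖ ≤ B := fun n =>
      (hB n).trans (mul_le_of_le_one_right hB0
        (Real.rpow_le_one_of_one_le_of_nonpos (by simp) (by simp; linarith)))
    have key : ∀ k N : ℕ, 2 * ∑ n ∈ Finset.range (N + 1),
          PowerSeries.coeff n (binomPS (-ν) (-1)) * betaMoment ν s (n + k) =
        ∑ n ∈ Finset.range (N + 1),
          PowerSeries.coeff n (binomPS (-ν - 1) (-1)) * betaMoment ν s (n + k) +
        ∑ n ∈ Finset.range (N + 1), PowerSeries.coeff n (binomPS (-ν) (-1)) *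
          ((ν + 1) * betaMoment (ν + 1) s (n + k)) +
        PowerSeries.coeff N (binomPS (-ν) (-1)) * betaMoment ν s (N + k + 1) := by
      intro k N
      simp_rw [← betaMoment_sub_succ]
      induction N with
      | zero =>
        simp [constantCoeff_binomPS]
        ring
      | succ N ih =>
        rw [Finset.sum_range_succ, mul_add, ih, Finset.sum_range_succ _ (N + 1),
          Finset.sum_range_succ _ (N + 1), coeff_succ_binomPS_sub_one,
          show N + 1 + k = N + k + 1 by ring]
        ring
    have hs1 : Summable fun n : ℕ => A * ((n : ℝ) + 1) ^ ((-ν - 1).re - 1) * M :=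
      ((summable_natCast_add_one_rpow (by simp; linarith)).mul_left A).mul_right M
    have hs2 : Summable fun n : ℕ =>
        B * ‖ν + 1‖ * L * ((n : ℝ) + 1) ^ (((-ν).re - 1) + (-(ν + 1).re - 1)) :=
      (summable_natCast_add_one_rpow (by simp; linarith)).mul_left _
    have hb1 : ∀ k n, ‖PowerSeries.coeff n (binomPS (-ν - 1) (-1)) * betaMoment ν s (n + k)‖ ≤
        A * ((n : ℝ) + 1) ^ ((-ν - 1).re - 1) * M := fun k n => by
      rw [norm_mul]
      exact mul_le_mul (hA n) (hM1 _) (norm_nonneg _) ((norm_nonneg _).trans (hA n))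
    have hb2 : ∀ k n, ‖PowerSeries.coeff n (binomPS (-ν) (-1)) *
          ((ν + 1) * betaMoment (ν + 1) s (n + k))‖ ≤
        B * ‖ν + 1‖ * L * ((n : ℝ) + 1) ^ (((-ν).re - 1) + (-(ν + 1).re - 1)) := fun k n => by
      rw [norm_mul, norm_mul, Real.rpow_add (by positivity)]
      have h1 := (hL (n + k)).trans (mul_le_mul_of_nonneg_left
        (natCast_add_one_rpow_le_of_nonpos (by simp; linarith) n k) hL0)
      refine (mul_le_mul (hB n) (mul_le_mul_of_nonneg_left h1 (norm_nonneg _)) (by positivity)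
        ((norm_nonneg _).trans (hB n))).trans_eq ?_
      ring
    refine ⟨∑' n : ℕ, A * ((n : ℝ) + 1) ^ ((-ν - 1).re - 1) * M + ∑' n : ℕ,
      B * ‖ν + 1‖ * L * ((n : ℝ) + 1) ^ (((-ν).re - 1) + (-(ν + 1).re - 1)) + B * M,
      fun k N => ?_⟩
    have hp1 : 0 ≤ ∑' n : ℕ, A * ((n : ℝ) + 1) ^ ((-ν - 1).re - 1) * M :=
      tsum_nonneg fun n => (norm_nonneg _).trans (hb1 0 n)
    have hp2 : 0 ≤ ∑' n : ℕ,
        B * ‖ν + 1‖ * L * ((n : ℝ) + 1) ^ (((-ν).re - 1) + (-(ν + 1).re - 1)) :=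
      tsum_nonneg fun n => (norm_nonneg _).trans (hb2 0 n)
    cases N with
    | zero =>
      rw [Finset.sum_range_zero, norm_zero]
      positivity
    | succ N =>
      refine (le_mul_of_one_le_left (norm_nonneg _) (one_le_two (α := ℝ))).trans ?_
      rw [show (2 : ℝ) = ‖(2 : ℂ)‖ by simp, ← norm_mul, key]
      refine (norm_add_le _ _).trans (add_le_add ((norm_add_le _ _).trans (add_le_add ?_ ?_)) ?_)
      · exact (norm_sum_le _ _).trans ((Finset.sum_le_sum fun n _ => hb1 k n).trans
          (hs1.sum_le_tsum _ fun n _ => (norm_nonneg _).trans (hb1 0 n)))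
      · exact (norm_sum_le _ _).trans ((Finset.sum_le_sum fun n _ => hb2 k n).trans
          (hs2.sum_le_tsum _ fun n _ => (norm_nonneg _).trans (hb2 0 n)))
      · rw [norm_mul]
        exact mul_le_mul (hB1 N) (hM1 _) (norm_nonneg _) hB0
  · let M := ∑ i ∈ Finset.range (j + 1), ‖betaMoment ν (-j) i‖
    have hM : ∀ i, ‖betaMoment ν (-j) i‖ ≤ M := by
      intro i
      by_cases hi : i < j + 1
      · exact Finset.single_le_sum (f := fun i => ‖betaMoment ν (-j) i‖)
          (fun _ _ => norm_nonneg _) (Finset.mem_range.mpr hi)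
      · rw [betaMoment_neg_eq_zero ν (by omega), norm_zero]
        exact Finset.sum_nonneg fun _ _ => norm_nonneg _
    have hM0 : 0 ≤ M := (norm_nonneg _).trans (hM 0)
    refine ⟨∑ n ∈ Finset.range (j + 1), ‖PowerSeries.coeff n (binomPS (-ν) (-1))‖ * M,
      fun k N => ?_⟩
    rw [← Finset.sum_filter_add_sum_filter_not (Finset.range N) (fun n => n < j + 1)]
    rw [Finset.sum_eq_zero (s := (Finset.range N).filter fun n => ¬ n < j + 1), add_zero]
    · refine (norm_sum_le _ _).trans ((Finset.sum_le_sum fun n _ => ?_).trans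
        (Finset.sum_le_sum_of_subset_of_nonneg (fun n hn => ?_) fun n _ _ => by positivity))
      · rw [norm_mul]
        exact mul_le_mul_of_nonneg_left (hM _) (norm_nonneg _)
      · exact Finset.mem_range.mpr (Finset.mem_filter.mp hn).2
    · intro n hn
      rw [betaMoment_neg_eq_zero ν (by have := (Finset.mem_filter.mp hn).2; omega), mul_zero]

/-- `(s)_n 2^{-n} / (Γ((s + n + 1) / 2) Γ((s + n) / 2 + ν + 1))`, a regularized moment of the
weight `(1 - u²)^ν`. -/
def halfMoment (ν s : ℂ) (n : ℕ) : ℂ :=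
  poch s n / 2 ^ n * (Complex.Gamma ((s + n + 1) / 2))⁻¹ *
    (Complex.Gamma ((s + n) / 2 + ν + 1))⁻¹

theorem poch_mul_kummerSum (ν s : ℂ) (k : ℕ) :
    poch s k * kummerSum ν (s + k) = (√Real.pi : ℝ) * 2 ^ (-s) * halfMoment ν s k := by
  rw [kummerSum, halfMoment, neg_add, Complex.cpow_add _ _ two_ne_zero, Complex.cpow_neg _ (k : ℂ),
    Complex.cpow_natCast]
  ring

theorem halfMoment_add (ν s : ℂ) (k n : ℕ) :
    halfMoment ν s (n + k) = poch s k / 2 ^ k * halfMoment ν (s + k) n := by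
  rw [halfMoment, halfMoment, add_comm n k, poch_add, pow_add]
  push_cast
  rw [← add_assoc s]
  ring

theorem halfMoment_eq_mul_add_one (ν s : ℂ) (n : ℕ) :
    halfMoment ν s n = ((s + n) / 2 + ν + 1) * halfMoment (ν + 1) s n := by
  rw [halfMoment, halfMoment, inv_Gamma_eq ((s + n) / 2 + ν + 1),
    show (s + n) / 2 + (ν + 1) + 1 = (s + n) / 2 + ν + 1 + 1 by ring]
  ring

theorem halfMoment_two_mul (ν s : ℂ) (j : ℕ) :
    halfMoment ν s (2 * j) = (Complex.Gamma ((s + 1) / 2))⁻¹ *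
      (poch (s / 2) j * (Complex.Gamma (s / 2 + ν + 1 + j))⁻¹) := by
  have h := poch_mul_inv_Gamma ((s + 1) / 2) j
  have h4 : (2 : ℂ) ^ (2 * j) = 4 ^ j := by rw [pow_mul]; norm_num
  rw [halfMoment, poch_two_mul, ← h, h4]
  push_cast
  rw [show (s + 2 * (j : ℂ) + 1) / 2 = (s + 1) / 2 + j by ring,
    show (s + 2 * (j : ℂ)) / 2 + ν + 1 = s / 2 + ν + 1 + j by ring]
  field_simp

theorem rpow_le_rpow_abs_mul_rpow {x y c : ℝ} (r : ℝ) (hx : 0 < x) (hy : 0 < y) (hc : 1 ≤ c)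
    (hxy : x ≤ c * y) (hyx : y ≤ c * x) : x ^ r ≤ c ^ |r| * y ^ r := by
  have hc0 : 0 < c := by linarith
  rcases le_total 0 r with hr | hr
  · rw [abs_of_nonneg hr, ← Real.mul_rpow hc0.le hy.le]
    exact Real.rpow_le_rpow hx.le hxy hr
  · rw [abs_of_nonpos hr]
    have h := Real.rpow_le_rpow_of_nonpos hy hyx hr
    rw [Real.mul_rpow hc0.le hx.le] at h
    rw [Real.rpow_neg hc0.le]
    have hcr : 0 < c ^ r := Real.rpow_pos_of_pos hc0 r
    field_simp
    linarith

theorem exists_norm_halfMoment_le (ν s : ℂ) :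
    ∃ C : ℝ, ∀ n : ℕ, ‖halfMoment ν s n‖ ≤ C * ((n : ℝ) + 1) ^ (-ν.re - 1) := by
  have even : ∀ s, ∃ C : ℝ, ∀ j : ℕ,
      ‖halfMoment ν s (2 * j)‖ ≤ C * ((j : ℝ) + 1) ^ (-ν.re - 1) := by
    intro s
    obtain ⟨C, hC⟩ := exists_norm_poch_mul_inv_Gamma_le (s / 2) (s / 2 + ν + 1)
    refine ⟨‖(Complex.Gamma ((s + 1) / 2))⁻¹‖ * C, fun j => ?_⟩
    rw [halfMoment_two_mul, norm_mul, mul_assoc]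
    refine mul_le_mul_of_nonneg_left ((hC j).trans_eq ?_) (norm_nonneg _)
    congr 2
    simp
    ring
  obtain ⟨A, hA⟩ := even s
  obtain ⟨B, hB⟩ := even (s + 1)
  have hA0 : 0 ≤ A := by simpa using (norm_nonneg _).trans (hA 0)
  have hB0 : 0 ≤ B := by simpa using (norm_nonneg _).trans (hB 0)
  refine ⟨(A + ‖s / 2‖ * B) * 2 ^ |-ν.re - 1|, fun n => ?_⟩
  have hr := fun j : ℕ => Real.rpow_nonneg (by positivity : (0 : ℝ) ≤ (j : ℝ) + 1) (-ν.re - 1)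
  have aux : ∀ j : ℕ, n = 2 * j ∨ n = 2 * j + 1 →
      ((j : ℝ) + 1) ^ (-ν.re - 1) ≤ 2 ^ |-ν.re - 1| * ((n : ℝ) + 1) ^ (-ν.re - 1) := by
    intro j hj
    have h1 : (j : ℝ) + 1 ≤ 2 * ((n : ℝ) + 1) := by norm_cast; omega
    have h2 : (n : ℝ) + 1 ≤ 2 * ((j : ℝ) + 1) := by norm_cast; omega
    exact rpow_le_rpow_abs_mul_rpow _ (by positivity) (by positivity) one_le_two h1 h2
  have hle : ∀ j : ℕ, n = 2 * j ∨ n = 2 * j + 1 →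
      ‖halfMoment ν s n‖ ≤ (A + ‖s / 2‖ * B) * ((j : ℝ) + 1) ^ (-ν.re - 1) := by
    rintro j (rfl | rfl)
    · refine (hA j).trans (mul_le_mul_of_nonneg_right ?_ (hr j))
      have := mul_nonneg (norm_nonneg (s / 2)) hB0
      linarith
    · have h := halfMoment_add ν s 1 (2 * j)
      rw [Nat.cast_one, poch_one, pow_one] at h
      rw [h, norm_mul]
      refine (mul_le_mul_of_nonneg_left (hB j) (norm_nonneg _)).trans ?_
      rw [← mul_assoc]
      refine mul_le_mul_of_nonneg_right ?_ (hr j)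
      linarith
  obtain ⟨j, hj⟩ := Nat.even_or_odd' n
  refine (hle j hj).trans ?_
  rw [mul_assoc]
  exact mul_le_mul_of_nonneg_left (aux j hj)
    (add_nonneg hA0 (mul_nonneg (norm_nonneg _) hB0))

/-- The terms of the series dual to Kummer's, and of its shifts, decay quadratically. -/
theorem exists_norm_binom_mul_halfMoment_le (ν s : ℂ) :
    ∃ (C : ℝ) (D : ℕ), ∀ k n : ℕ,
      ‖PowerSeries.coeff n (binomPS ν (-1)) * halfMoment ν s (n + k)‖ ≤
        C * ((k : ℝ) + 1) ^ D * ((n : ℝ) + 1) ^ (-2 : ℝ) := by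
  obtain ⟨A, hA⟩ := exists_norm_coeff_binomPS_le ν
  obtain ⟨B, hB⟩ := exists_norm_halfMoment_le ν s
  obtain ⟨D, hD⟩ := exists_nat_ge |-ν.re - 1|
  have hA0 := nonneg_of_norm_le_mul_rpow hA
  have hB0 := nonneg_of_norm_le_mul_rpow hB
  refine ⟨A * B, D, fun k n => ?_⟩
  have hk : (1 : ℝ) ≤ (k : ℝ) + 1 := by simp
  have h1 : (((n + k : ℕ) : ℝ) + 1) ^ (-ν.re - 1) ≤
      ((k : ℝ) + 1) ^ D * ((n : ℝ) + 1) ^ (-ν.re - 1) := by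
    refine (rpow_le_rpow_abs_mul_rpow _ (by positivity) (by positivity : (0 : ℝ) < (n : ℝ) + 1) hk
      ?_ ?_).trans (mul_le_mul_of_nonneg_right ?_ (by positivity))
    · push_cast
      nlinarith [mul_nonneg (Nat.cast_nonneg n : (0 : ℝ) ≤ n) (Nat.cast_nonneg k : (0 : ℝ) ≤ k)]
    · push_cast
      nlinarith [mul_nonneg (Nat.cast_nonneg n : (0 : ℝ) ≤ n) (Nat.cast_nonneg k : (0 : ℝ) ≤ k),
        mul_nonneg (Nat.cast_nonneg k : (0 : ℝ) ≤ k) (Nat.cast_nonneg k : (0 : ℝ) ≤ k)]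
    · rw [← Real.rpow_natCast]
      exact Real.rpow_le_rpow_of_exponent_le hk hD
  rw [norm_mul]
  refine (mul_le_mul (hA n) ((hB (n + k)).trans (mul_le_mul_of_nonneg_left h1 hB0))
    (norm_nonneg _) (by positivity)).trans_eq ?_
  rw [show (-2 : ℝ) = (ν.re - 1) + (-ν.re - 1) by ring, Real.rpow_add (by positivity)]
  ring

theorem summable_binom_mul_halfMoment (ν s : ℂ) (k : ℕ) :
    Summable fun n => PowerSeries.coeff n (binomPS ν (-1)) * halfMoment ν s (n + k) := by
  obtain ⟨C, D, h⟩ := exists_norm_binom_mul_halfMoment_le ν s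
  exact Summable.of_norm_bounded ((summable_natCast_add_one_rpow (by norm_num)).mul_left _) (h k)

theorem hasSum_binom_mul_halfMoment_of_re_pos (ν s : ℂ) (hν : 0 < ν.re) :
    HasSum (fun n => PowerSeries.coeff n (binomPS ν (-1)) * halfMoment ν s n)
      (2 ^ s * ((√Real.pi : ℝ) : ℂ)⁻¹ * (Complex.Gamma (1 + ν + s))⁻¹) := by
  obtain ⟨A, hA⟩ := exists_norm_coeff_binomPS_le ν
  obtain ⟨B, hB⟩ := exists_norm_coeff_binomPS_le (-ν)
  obtain ⟨M, hM⟩ := exists_norm_betaMoment_le ν s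
  have hA0 := nonneg_of_norm_le_mul_rpow hA
  have hB0 := nonneg_of_norm_le_mul_rpow hB
  have hM0 := nonneg_of_norm_le_mul_rpow hM
  have hF : Summable fun p : ℕ × ℕ => PowerSeries.coeff p.1 (binomPS ν (-1)) *
      (PowerSeries.coeff p.2 (binomPS (-ν) (-1)) * betaMoment ν s (p.2 + p.1)) := by
    have h1 : Summable fun n : ℕ => ((n : ℝ) + 1) ^ (-2 : ℝ) :=
      summable_natCast_add_one_rpow (by norm_num)
    have h2 : Summable fun n : ℕ => ((n : ℝ) + 1) ^ ((-ν).re - 1) :=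
      summable_natCast_add_one_rpow (by simp; linarith)
    refine Summable.of_norm_bounded ((h1.mul_of_nonneg h2 (fun n => ?_) (fun n => ?_)).mul_left
      (A * B * M)) fun p => ?_
    · simp only [Pi.zero_apply]; positivity
    · simp only [Pi.zero_apply]; positivity
    · rw [norm_mul, norm_mul, add_comm p.2]
      have h3 := (hM (p.1 + p.2)).trans (mul_le_mul_of_nonneg_left
        (natCast_add_one_rpow_le_of_nonpos (by linarith) p.1 p.2) hM0)
      refine (mul_le_mul (hA p.1) (mul_le_mul (hB p.2) h3 (norm_nonneg _) (by positivity))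
        (by positivity) (by positivity)).trans_eq ?_
      rw [show (-2 : ℝ) = (ν.re - 1) + (-ν.re - 1) by ring, Real.rpow_add (by positivity)]
      ring
  have hsum : ∀ k, Summable fun j =>
      PowerSeries.coeff j (binomPS (-ν) (-1)) * betaMoment ν s (j + k) := by
    intro k
    refine Summable.of_norm_bounded ((summable_natCast_add_one_rpow
      (r := (-ν).re - 1) (by simp; linarith)).mul_left (B * M)) fun n => ?_
    rw [norm_mul]
    have h3 : ‖betaMoment ν s (n + k)‖ ≤ M := (hM _).trans (mul_le_of_le_one_right hM0
      (Real.rpow_le_one_of_one_le_of_nonpos (by simp; positivity) (by linarith)))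
    refine (mul_le_mul (hB n) h3 (norm_nonneg _) (by positivity)).trans_eq ?_
    ring
  have hin : ∀ k, ∑' j, PowerSeries.coeff j (binomPS (-ν) (-1)) * betaMoment ν s (j + k) =
      (√Real.pi : ℝ) * 2 ^ (-s) * halfMoment ν s k := fun k => by
    rw [← poch_mul_kummerSum]
    exact tendsto_nhds_unique (hsum k).hasSum.tendsto_sum_nat
      (seriesSum_kummer_shift ν s (Or.inl (by linarith)) k)
  have h := tsum_coeff_mul_tsum_coeff_mul_of_summable hF
  simp_rw [hin] at h
  have h0 : ∑' n, PowerSeries.coeff n (1 : PowerSeries ℂ) * betaMoment ν s n = betaMoment ν s 0 :=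
    (tsum_eq_single 0 fun n hn => by rw [PowerSeries.coeff_one, if_neg hn, zero_mul]).trans
      (by simp)
  rw [binomPS_mul_neg, h0] at h
  have hs := summable_binom_mul_halfMoment ν s 0
  simp only [add_zero] at hs
  have e : ∑' n, PowerSeries.coeff n (binomPS ν (-1)) * halfMoment ν s n =
      2 ^ s * ((√Real.pi : ℝ) : ℂ)⁻¹ * (Complex.Gamma (1 + ν + s))⁻¹ := by
    have hpi := ofReal_sqrt_pi_ne_zero
    have h2 : (2 : ℂ) ^ s ≠ 0 := by simp [Complex.cpow_eq_zero_iff]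
    simp_rw [mul_left_comm _ (((√Real.pi : ℝ) : ℂ) * 2 ^ (-s))] at h
    rw [tsum_mul_left, Complex.cpow_neg] at h
    simp [betaMoment, poch_zero] at h
    field_simp at h ⊢
    linear_combination h
  rw [← e]
  exact hs.hasSum

theorem hasSum_binom_mul_halfMoment_of_add_one (ν : ℂ)
    (h : ∀ s, HasSum (fun n => PowerSeries.coeff n (binomPS (ν + 1) (-1)) * halfMoment (ν + 1) s n)
      (2 ^ s * ((√Real.pi : ℝ) : ℂ)⁻¹ * (Complex.Gamma (1 + (ν + 1) + s))⁻¹)) (s : ℂ) :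
    HasSum (fun n => PowerSeries.coeff n (binomPS ν (-1)) * halfMoment ν s n)
      (2 ^ s * ((√Real.pi : ℝ) : ℂ)⁻¹ * (Complex.Gamma (1 + ν + s))⁻¹) := by
  have h1 := (h s).mul_left (s / 2 + ν + 1)
  have h2 := (h (s + 1)).mul_left ((s + ν + 2) / 2 * (s / 2))
  rw [← hasSum_nat_add_iff' 1] at h1 ⊢
  have h3 := h1.add h2
  simp only [Finset.sum_range_one, constantCoeff_binomPS, one_mul] at h3 ⊢
  convert h3 using 1
  · ext n
    have hm := halfMoment_add (ν + 1) s 1 n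
    rw [Nat.cast_one, poch_one, pow_one] at hm
    have hP := coeff_succ_binomPS_sub_one (ν + 1) (-1) n
    rw [add_sub_cancel_right] at hP
    have hQ : ((n : ℂ) + 1) * PowerSeries.coeff (n + 1) (binomPS ν (-1)) =
        -ν * PowerSeries.coeff n (binomPS (ν + 1) (-1)) := by
      have h1 : (n.factorial : ℂ) ≠ 0 := by exact_mod_cast n.factorial_ne_zero
      have h2 : ((n : ℂ) + 1) ≠ 0 := by exact_mod_cast n.succ_ne_zero
      rw [coeff_binomPS, coeff_binomPS, poch_succ_left, Nat.factorial_succ, pow_succ]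
      push_cast
      field_simp
    rw [halfMoment_eq_mul_add_one]
    push_cast
    rw [show (s + ν + 2) / 2 * (s / 2) * (PowerSeries.coeff n (binomPS (ν + 1) (-1)) *
      halfMoment (ν + 1) (s + 1) n) = (s + ν + 2) / 2 *
      PowerSeries.coeff n (binomPS (ν + 1) (-1)) * (s / 2 * halfMoment (ν + 1) (s + 1) n) by ring,
      ← hm]
    linear_combination (halfMoment (ν + 1) s (n + 1) / 2) * hQ +
      (halfMoment (ν + 1) s (n + 1) * (s / 2 + ν + 1)) * hP
  · have hm := halfMoment_eq_mul_add_one ν s 0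
    rw [Nat.cast_zero, add_zero] at hm
    have h1 := inv_Gamma_eq (1 + ν + s)
    have h2 := inv_Gamma_eq (1 + ν + s + 1)
    rw [hm, h1, h2, Complex.cpow_add _ _ two_ne_zero, Complex.cpow_one,
      show 1 + (ν + 1) + s = 1 + ν + s + 1 by ring,
      show 1 + (ν + 1) + (s + 1) = 1 + ν + s + 1 + 1 by ring, h2]
    ring

/-- The summation formula dual to Kummer's. -/
theorem hasSum_binom_mul_halfMoment (ν s : ℂ) :
    HasSum (fun n => PowerSeries.coeff n (binomPS ν (-1)) * halfMoment ν s n)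
      (2 ^ s * ((√Real.pi : ℝ) : ℂ)⁻¹ * (Complex.Gamma (1 + ν + s))⁻¹) := by
  have ind : ∀ p : ℕ, ∀ ν : ℂ, 0 < ν.re + p → ∀ s,
      HasSum (fun n => PowerSeries.coeff n (binomPS ν (-1)) * halfMoment ν s n)
        (2 ^ s * ((√Real.pi : ℝ) : ℂ)⁻¹ * (Complex.Gamma (1 + ν + s))⁻¹) := by
    intro p
    induction p with
    | zero => exact fun ν h s => hasSum_binom_mul_halfMoment_of_re_pos ν s (by simpa using h)
    | succ p ih =>
      refine fun ν h => hasSum_binom_mul_halfMoment_of_add_one ν (ih (ν + 1) ?_)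
      push_cast at h
      simp
      linarith
  obtain ⟨p, hp⟩ := exists_nat_gt (-ν.re)
  exact ind p ν (by linarith) s

theorem seriesSum_binom_mul_halfMoment_shift (ν s : ℂ) (k : ℕ) :
    SeriesSum (fun n => PowerSeries.coeff n (binomPS ν (-1)) * halfMoment ν s (n + k))
      (2 ^ s * ((√Real.pi : ℝ) : ℂ)⁻¹ * betaMoment ν s k) := by
  have h := ((hasSum_binom_mul_halfMoment ν (s + k)).mul_left (poch s k / 2 ^ k)).tendsto_sum_nat
  rw [Complex.cpow_add _ _ two_ne_zero, Complex.cpow_natCast] at h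
  unfold SeriesSum
  convert h using 1
  · ext N
    exact Finset.sum_congr rfl fun n _ => by simp only [halfMoment_add]; ring
  · rw [betaMoment, ← add_assoc]
    field_simp

theorem exists_norm_sum_binom_mul_halfMoment_le (ν s : ℂ) :
    ∃ (C : ℝ) (D : ℕ), ∀ k N : ℕ, ‖∑ n ∈ Finset.range N,
      PowerSeries.coeff n (binomPS ν (-1)) * halfMoment ν s (n + k)‖ ≤ C * ((k : ℝ) + 1) ^ D := by
  obtain ⟨C, D, h⟩ := exists_norm_binom_mul_halfMoment_le ν s
  have hs : Summable fun n : ℕ => ((n : ℝ) + 1) ^ (-2 : ℝ) :=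
    summable_natCast_add_one_rpow (by norm_num)
  refine ⟨C * ∑' n : ℕ, ((n : ℝ) + 1) ^ (-2 : ℝ), D, fun k N => ?_⟩
  refine (norm_sum_le _ _).trans ((Finset.sum_le_sum fun n _ => h k n).trans
    (((hs.mul_left (C * ((k : ℝ) + 1) ^ D)).sum_le_tsum _ fun n _ =>
      (norm_nonneg _).trans (h k n)).trans_eq ?_))
  rw [tsum_mul_left]
  ring

/-- The coefficients of `(1 - q z)^τ (1 + z)^{-τ} (1 + q z²)^{-τ}`. -/
def scaledG (n : ℕ) (τ q : ℂ) : ℂ :=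
  PowerSeries.coeff n (binomPS (-τ) q * binomPS τ (-1) * binomSqScaledPS τ q)

theorem polyG_mul_pow (n : ℕ) (τ : ℂ) {w : ℂ} (hw : w ≠ 0) :
    polyG n τ τ w * w ^ n = scaledG n τ (w ^ 2) := by
  rw [polyG, scaledG, mul_comm, ← PowerSeries.coeff_rescale,
    map_mul (PowerSeries.rescale w), map_mul (PowerSeries.rescale w), rescale_binomPS,
    rescale_binomPS, rescale_binomSqPS, mul_neg, mul_inv_cancel₀ hw, sq]

theorem polyGhat_mul_pow (n : ℕ) (τ : ℂ) {w : ℂ} (hw : w ≠ 0) :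
    polyGhat n τ τ w * w ^ n = scaledG n τ (-w ^ 2) := by
  have h := polyG_mul_pow n τ (mul_ne_zero Complex.I_ne_zero hw)
  rw [mul_pow, mul_pow, Complex.I_sq, neg_one_mul] at h
  rw [polyGhat, ← h]
  ring

theorem tsum_coeff_binomSqScaledPS_mul_halfMoment (ν s q : ℂ) (n : ℕ) :
    ∑' k, PowerSeries.coeff k (binomSqScaledPS (-ν) q) * halfMoment ν s (n + k) =
      poch s n / 2 ^ n * (Complex.Gamma ((s + n + 1) / 2))⁻¹ *
        regF (-ν) ((s + n) / 2) (1 + ν + (s + n) / 2) (-q) := by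
  have hinj : Function.Injective (fun k : ℕ => 2 * k) := fun a b hab => by simpa using hab
  rw [← hinj.tsum_eq, regF, ← tsum_mul_left]
  · refine tsum_congr fun k => ?_
    rw [coeff_binomSqScaledPS_two_mul, add_comm n, halfMoment_add, halfMoment_two_mul,
      show (s + n) / 2 + ν + 1 + (k : ℂ) = 1 + ν + (s + n) / 2 + k by ring]
    simp only [div_eq_mul_inv, mul_inv]
    ring
  · intro k hk
    rw [Function.mem_support] at hk
    by_contra hne
    refine hk ?_
    rw [coeff_binomSqScaledPS_of_not_even, zero_mul]
    rintro ⟨j, hj⟩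
    exact hne ⟨j, by simp only; omega⟩

theorem tsum_coeff_binomPS_mul_betaMoment (ν s q : ℂ) (n : ℕ) :
    ∑' k, PowerSeries.coeff k (binomPS (-ν) q) * betaMoment ν s (n + k) =
      poch s n * regF (-ν) (s + n) (1 + ν + (s + n)) q := by
  rw [regF, ← tsum_mul_left]
  refine tsum_congr fun k => ?_
  rw [coeff_binomPS, add_comm n, betaMoment_add, betaMoment]
  simp only [div_eq_mul_inv, mul_inv]
  ring

theorem seriesSum_scaledG_mul_regF_neg (ν s : ℂ) {q : ℂ} (hq : ‖q‖ < 1) :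
    SeriesSum (fun n => scaledG n ν q * (poch s n / 2 ^ n *
        (Complex.Gamma ((s + n + 1) / 2))⁻¹ *
        regF (-ν) ((s + n) / 2) (1 + ν + (s + n) / 2) (-q)))
      (2 ^ s * ((√Real.pi : ℝ) : ℂ)⁻¹ * regF (-ν) s (1 + ν + s) q) := by
  obtain ⟨C, D, hC⟩ := exists_norm_sum_binom_mul_halfMoment_le ν s
  have h := seriesSum_coeff_mul_tsum (seriesSum_binom_mul_halfMoment_shift ν s) hC
    (constantCoeff_binomPS _ _)
    ((rapidlyDecreasing_binomPS (-ν) hq).mul (rapidlyDecreasing_binomSqScaledPS ν hq))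
    (rapidlyDecreasing_binomSqScaledPS (-ν) hq)
  have h0 := tsum_coeff_binomPS_mul_betaMoment ν s q 0
  simp only [zero_add, poch_zero, one_mul, Nat.cast_zero, add_zero] at h0
  have hg : binomSqScaledPS (-ν) q * (binomPS (-ν) q * binomSqScaledPS ν q) = binomPS (-ν) q := by
    linear_combination binomPS (-ν) q * binomSqScaledPS_mul_neg ν q
  simp_rw [hg, mul_left_comm _ (2 ^ s * ((√Real.pi : ℝ) : ℂ)⁻¹)] at h
  rw [tsum_mul_left, h0] at h
  convert h using 2 with n
  rw [tsum_coeff_binomSqScaledPS_mul_halfMoment, scaledG]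
  congr 2
  ring

theorem seriesSum_scaledG_mul_regF (ν s : ℂ) (hs : -1 < ν.re ∨ ∃ k : ℕ, s = -k) {q : ℂ}
    (hq : ‖q‖ < 1) :
    SeriesSum (fun n => scaledG n (-ν) q * (poch s n * regF (-ν) (s + n) (1 + ν + (s + n)) q))
      ((√Real.pi : ℝ) * 2 ^ (-s) * ((Complex.Gamma ((s + 1) / 2))⁻¹ *
        regF (-ν) (s / 2) (1 + ν + s / 2) (-q))) := by
  obtain ⟨C, hC⟩ := exists_norm_sum_kummer_le ν s hs
  have h := seriesSum_coeff_mul_tsum (C := C) (D := 0) (seriesSum_kummer_shift ν s hs)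
    (by simpa using hC) (constantCoeff_binomPS _ _)
    ((rapidlyDecreasing_binomPS ν hq).mul (rapidlyDecreasing_binomSqScaledPS (-ν) hq))
    (rapidlyDecreasing_binomPS (-ν) hq)
  have h0 := tsum_coeff_binomSqScaledPS_mul_halfMoment ν s q 0
  simp only [zero_add, poch_zero, pow_zero, div_one, one_mul, Nat.cast_zero, add_zero] at h0
  have hg : binomPS (-ν) q * (binomPS ν q * binomSqScaledPS (-ν) q) = binomSqScaledPS (-ν) q := by
    linear_combination binomSqScaledPS (-ν) q * binomPS_mul_neg ν q
  simp_rw [hg, poch_mul_kummerSum, mul_left_comm _ (((√Real.pi : ℝ) : ℂ) * 2 ^ (-s))] at h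
  rw [tsum_mul_left, h0] at h
  convert h using 2 with n
  rw [tsum_coeff_binomPS_mul_betaMoment, scaledG, neg_neg]
  congr 2
  ring

theorem mutuallyInverse_of_mul_eq_one (ν : ℂ) {F F' : PowerSeries ℂ} (h : F * F' = 1) :
    MutuallyInverse (fun s n => poch (s - ν) n * PowerSeries.coeff n F / 2 ^ n)
      (fun s n => poch (s - ν) n * PowerSeries.coeff n F' / 2 ^ n) := by
  have key : ∀ (F F' : PowerSeries ℂ), F * F' = 1 → ∀ (s : ℂ) (n : ℕ),
      ∑ k ∈ Finset.range (n + 1), poch (s - ν) k * PowerSeries.coeff k F / 2 ^ k *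
        (poch (s + k - ν) (n - k) * PowerSeries.coeff (n - k) F' / 2 ^ (n - k)) =
        if n = 0 then 1 else 0 := by
    intro F F' h s n
    have h1 : PowerSeries.coeff n (F * F') = if n = 0 then 1 else 0 := by
      rw [h, PowerSeries.coeff_one]
    rw [PowerSeries.coeff_mul, Finset.Nat.sum_antidiagonal_eq_sum_range_succ_mk] at h1
    have h2 : ∑ k ∈ Finset.range (n + 1), poch (s - ν) k * PowerSeries.coeff k F / 2 ^ k *
        (poch (s + k - ν) (n - k) * PowerSeries.coeff (n - k) F' / 2 ^ (n - k)) =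
        poch (s - ν) n / 2 ^ n * if n = 0 then 1 else 0 := by
      rw [← h1, Finset.mul_sum]
      refine Finset.sum_congr rfl fun k hk => ?_
      obtain ⟨j, rfl⟩ := Nat.exists_eq_add_of_le (Nat.lt_succ_iff.mp (Finset.mem_range.mp hk))
      rw [poch_add, pow_add, Nat.add_sub_cancel_left, show s + k - ν = s - ν + k by ring]
      field_simp
    rw [h2]
    split_ifs with h3
    · simp [h3, poch_zero]
    · simp
  exact fun s n => ⟨key F F' h s n, key F' F (by rw [mul_comm, h]) s n⟩

theorem genG_mul_neg (ν w : ℂ) :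
    (binomPS (-ν) w * binomPS ν (-w⁻¹) * binomSqPS ν) *
      (binomPS (- -ν) w * binomPS (-ν) (-w⁻¹) * binomSqPS (-ν)) = 1 := by
  have h1 := binomPS_mul_neg (-ν) w
  have h2 := binomPS_mul_neg ν (-w⁻¹)
  have h3 := binomSqPS_mul_neg ν
  calc _ = (binomPS (-ν) w * binomPS (- -ν) w) * (binomPS ν (-w⁻¹) * binomPS (-ν) (-w⁻¹)) *
        (binomSqPS ν * binomSqPS (-ν)) := by ring
    _ = 1 := by rw [h1, h2, h3, one_mul, one_mul]

theorem mutuallyInverse_polyG (ν w : ℂ) :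
    MutuallyInverse (fun s n => poch (s - ν) n * polyG n ν ν w / 2 ^ n)
      (fun s n => poch (s - ν) n * polyG n (-ν) (-ν) w / 2 ^ n) :=
  mutuallyInverse_of_mul_eq_one ν (genG_mul_neg ν w)

theorem mutuallyInverse_polyGhat (ν w : ℂ) :
    MutuallyInverse (fun s n => poch (s - ν) n * polyGhat n ν ν w / 2 ^ n)
      (fun s n => poch (s - ν) n * polyGhat n (-ν) (-ν) w / 2 ^ n) := by
  have h := congrArg (PowerSeries.rescale Complex.I) (genG_mul_neg ν (Complex.I * w))
  rw [map_mul, map_one] at h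
  have := mutuallyInverse_of_mul_eq_one ν h
  simp_rw [PowerSeries.coeff_rescale] at this
  exact this

theorem legendreP_eq (ν m : ℂ) {t r : ℝ} (ht : 0 < t) (hr : 0 ≤ r) (h : |1 - t| = r * (1 + t)) :
    legendreP ν m t = 2 ^ (-ν) * ((1 + t : ℝ) : ℂ) ^ ν * (r : ℂ) ^ (-m / 2) *
      regF (-ν) (-m - ν) (1 - m) (((t - 1) / (t + 1) : ℝ) : ℂ) := by
  have h1 : ((1 + t : ℝ) : ℂ) ≠ 0 := by exact_mod_cast (by linarith : (1 + t : ℝ) ≠ 0)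
  rw [legendreP, h, Complex.ofReal_mul, Complex.mul_cpow_ofReal_nonneg hr (by linarith),
    show (((1 + t : ℝ) : ℂ)) ^ ν = ((1 + t : ℝ) : ℂ) ^ (-m / 2) * ((1 + t : ℝ) : ℂ) ^ (ν + m / 2) by
      rw [← Complex.cpow_add _ _ h1]; ring_nf]
  ring

theorem legendreP_of_lt_one (ν m : ℂ) {x : ℝ} (hx0 : 0 < x) (hx1 : x < 1) :
    legendreP ν m x = 2 ^ (-ν) * ((1 + x : ℝ) : ℂ) ^ ν *
      (((1 - x) / (1 + x) : ℝ) : ℂ) ^ (-m / 2) *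
      regF (-ν) (-m - ν) (1 - m) (-(((1 - x) / (1 + x) : ℝ) : ℂ)) := by
  rw [legendreP_eq ν m hx0 (r := (1 - x) / (1 + x)) (div_nonneg (by linarith) (by linarith)),
    ← Complex.ofReal_neg, show (x - 1) / (x + 1) = -((1 - x) / (1 + x)) by
      rw [← neg_div, neg_sub, add_comm]]
  rw [abs_of_pos (by linarith), div_mul_cancel₀ _ (by linarith)]

theorem legendreP_one_div (ν m : ℂ) {x : ℝ} (hx0 : 0 < x) (hx1 : x < 1) :
    legendreP ν m (1 / x) = 2 ^ (-ν) * ((1 + x : ℝ) : ℂ) ^ ν * (x : ℂ) ^ (-ν) *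
      (((1 - x) / (1 + x) : ℝ) : ℂ) ^ (-m / 2) *
      regF (-ν) (-m - ν) (1 - m) (((1 - x) / (1 + x) : ℝ) : ℂ) := by
  have hx : 1 < 1 / x := by rwa [lt_div_iff₀ hx0, one_mul]
  have hx2 : (1 + x) ≠ 0 := by linarith
  rw [legendreP_eq ν m (by linarith) (r := (1 - x) / (1 + x))
    (div_nonneg (by linarith) (by linarith)),
    show (1 / x - 1) / (1 / x + 1) = (1 - x) / (1 + x) by field_simp,
    show 1 + 1 / x = (1 + x) * x⁻¹ by field_simp; ring,
    Complex.ofReal_mul, Complex.mul_cpow_ofReal_nonneg (by linarith) (by positivity),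
    Complex.ofReal_inv, Complex.inv_cpow _ _ (by
      rw [Complex.arg_ofReal_of_nonneg hx0.le]; exact Real.pi_ne_zero.symm), ← Complex.cpow_neg]
  · ring
  · rw [abs_of_neg (by linarith)]
    field_simp
    ring

theorem ofReal_sqrt_pow (r : ℝ) (hr : 0 ≤ r) (n : ℕ) : ((√r : ℝ) : ℂ) ^ n = (r : ℂ) ^ ((n : ℂ) / 2) := by
  rw [div_eq_mul_inv, Complex.cpow_nat_mul, Real.sqrt_eq_rpow, Complex.ofReal_cpow hr]
  norm_num

section Pair

variable {μ ν q c d : ℂ} {r : ℝ} {g : ℕ → ℂ} {L L' : ℂ → ℂ}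

theorem seriesSum_pair_direct (hr : 0 < r) (hq : ‖q‖ < 1) (hd : d ≠ 0)
    (hg : ∀ n, g n * ((√r : ℝ) : ℂ) ^ n = scaledG n ν q)
    (hL : ∀ m, L m = c * (r : ℂ) ^ (-m / 2) * regF (-ν) (-m - ν) (1 - m) (-q))
    (hL' : ∀ m, L' m = c * d * (r : ℂ) ^ (-m / 2) * regF (-ν) (-m - ν) (1 - m) q) :
    SeriesSum
      (fun n => poch (μ - ν) n * g n / (2 ^ n * Complex.Gamma ((n + μ - ν + 1) / 2)) *
        (r : ℂ) ^ ((n + μ - ν) / 4) * L (-((μ + ν + n) / 2)))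
      (L' (-μ) / ((√Real.pi : ℝ) * 2 ^ (ν - μ) * d)) := by
  have h := (seriesSum_scaledG_mul_regF_neg ν (μ - ν) hq).const_mul (c * (r : ℂ) ^ (μ / 2))
  have hr0 : (r : ℂ) ≠ 0 := by exact_mod_cast hr.ne'
  unfold SeriesSum
  convert h using 1
  · ext N
    rw [Finset.mul_sum]
    refine Finset.sum_congr rfl fun n _ => ?_
    have hp : (r : ℂ) ^ ((n + μ - ν) / 4) * (r : ℂ) ^ (- -((μ + ν + n) / 2) / 2) =
        (r : ℂ) ^ (μ / 2) * ((√r : ℝ) : ℂ) ^ n := by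
      rw [ofReal_sqrt_pow r hr.le, ← Complex.cpow_add _ _ hr0, ← Complex.cpow_add _ _ hr0]
      ring_nf
    beta_reduce
    rw [hL, ← hg, show (μ - ν + n + 1) / 2 = (n + μ - ν + 1) / 2 by ring,
      show (μ - ν + n) / 2 = - -((μ + ν + n) / 2) - ν by ring,
      show 1 + ν + (- -((μ + ν + n) / 2) - ν) = 1 - -((μ + ν + n) / 2) by ring, div_eq_mul_inv,
      mul_inv]
    linear_combination (poch (μ - ν) n * g n * ((2 ^ n)⁻¹ *
      (Complex.Gamma ((n + μ - ν + 1) / 2))⁻¹) * c *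
      regF (-ν) (- -((μ + ν + n) / 2) - ν) (1 - -((μ + ν + n) / 2)) (-q)) * hp
  · have hpi := ofReal_sqrt_pi_ne_zero
    have h2 : (2 : ℂ) ^ (μ - ν) ≠ 0 := by simp [Complex.cpow_eq_zero_iff]
    rw [hL', neg_neg, show 1 - -μ = 1 + ν + (μ - ν) by ring, ← neg_sub μ ν, Complex.cpow_neg]
    field_simp

theorem seriesSum_pair_inverse (hr : 0 < r) (hq : ‖q‖ < 1) (hd : d ≠ 0)
    (hν : -1 < ν.re ∨ ∃ k : ℕ, ν - μ = k)
    (hg : ∀ n, g n * ((√r : ℝ) : ℂ) ^ n = scaledG n (-ν) q)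
    (hL : ∀ m, L m = c * (r : ℂ) ^ (-m / 2) * regF (-ν) (-m - ν) (1 - m) (-q))
    (hL' : ∀ m, L' m = c * d * (r : ℂ) ^ (-m / 2) * regF (-ν) (-m - ν) (1 - m) q) :
    SeriesSum
      (fun n => poch (μ - ν) n * g n / ((√Real.pi : ℝ) * 2 ^ (ν - μ) * d) * L' (-μ - n))
      ((r : ℂ) ^ ((μ - ν) / 4) * (L (-((μ + ν) / 2)) / Complex.Gamma ((μ - ν + 1) / 2))) := by
  have hs : -1 < ν.re ∨ ∃ k : ℕ, μ - ν = -k :=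
    hν.imp_right fun ⟨k, hk⟩ => ⟨k, by rw [← hk, neg_sub]⟩
  have hpi := ofReal_sqrt_pi_ne_zero
  have h2 : (2 : ℂ) ^ (ν - μ) ≠ 0 := by simp [Complex.cpow_eq_zero_iff]
  have hr0 : (r : ℂ) ≠ 0 := by exact_mod_cast hr.ne'
  have h := (seriesSum_scaledG_mul_regF ν (μ - ν) hs hq).const_mul
    (c * (r : ℂ) ^ (μ / 2) * (((√Real.pi : ℝ) : ℂ) * 2 ^ (ν - μ))⁻¹)
  unfold SeriesSum
  convert h using 1
  · ext N
    rw [Finset.mul_sum]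
    refine Finset.sum_congr rfl fun n _ => ?_
    have hp : (r : ℂ) ^ (-(-μ - n) / 2) = (r : ℂ) ^ (μ / 2) * ((√r : ℝ) : ℂ) ^ n := by
      rw [ofReal_sqrt_pow r hr.le, ← Complex.cpow_add _ _ hr0]
      ring_nf
    beta_reduce
    rw [hL', ← hg, hp, show -(-μ - n) - ν = μ - ν + n by ring,
      show 1 - (-μ - n) = 1 + ν + (μ - ν + n) by ring]
    field_simp
  · have hp : (r : ℂ) ^ ((μ - ν) / 4) * (r : ℂ) ^ (- -((μ + ν) / 2) / 2) = (r : ℂ) ^ (μ / 2) := by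
      rw [← Complex.cpow_add _ _ hr0]
      ring_nf
    rw [hL, ← hp, neg_sub, show - -((μ + ν) / 2) - ν = (μ - ν) / 2 by ring,
      show 1 - -((μ + ν) / 2) = 1 + ν + (μ - ν) / 2 by ring]
    field_simp

end Pair

end

theorem theorem7 (x : ℝ) (hx0 : 0 < x) (hx1 : x < 1) (μ ν : ℂ) :
    -- first pair
    (SeriesSum
        (fun n => poch (μ - ν) n * polyG n ν ν (√((1 - x) / (1 + x)) : ℝ) /
            (2 ^ n * Complex.Gamma ((n + μ - ν + 1) / 2)) *
          (((1 - x) / (1 + x) : ℝ) : ℂ) ^ ((n + μ - ν) / 4) *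
          legendreP ν (-((μ + ν + n) / 2)) x)
        (legendreP ν (-μ) (1 / x) / ((√Real.pi : ℝ) * 2 ^ (ν - μ) * (x : ℂ) ^ (-ν)))) ∧
    ((-1 < ν.re ∨ ∃ k : ℕ, ν - μ = k) →
      SeriesSum
        (fun n => poch (μ - ν) n * polyG n (-ν) (-ν) (√((1 - x) / (1 + x)) : ℝ) /
            ((√Real.pi : ℝ) * 2 ^ (ν - μ) * (x : ℂ) ^ (-ν)) *
          legendreP ν (-μ - n) (1 / x))
        ((((1 - x) / (1 + x) : ℝ) : ℂ) ^ ((μ - ν) / 4) *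
          (legendreP ν (-((μ + ν) / 2)) x / Complex.Gamma ((μ - ν + 1) / 2)))) ∧
    MutuallyInverse
      (fun s n => poch (s - ν) n * polyG n ν ν (√((1 - x) / (1 + x)) : ℝ) / 2 ^ n)
      (fun s n => poch (s - ν) n * polyG n (-ν) (-ν) (√((1 - x) / (1 + x)) : ℝ) / 2 ^ n) ∧
    -- second pair
    (SeriesSum
        (fun n => poch (μ - ν) n * polyGhat n ν ν (√((1 - x) / (1 + x)) : ℝ) /
            (2 ^ n * Complex.Gamma ((n + μ - ν + 1) / 2)) *
          (((1 - x) / (1 + x) : ℝ) : ℂ) ^ ((n + μ - ν) / 4) *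
          legendreP ν (-((μ + ν + n) / 2)) (1 / x))
        (legendreP ν (-μ) x / ((√Real.pi : ℝ) * 2 ^ (ν - μ) * (x : ℂ) ^ ν))) ∧
    ((-1 < ν.re ∨ ∃ k : ℕ, ν - μ = k) →
      SeriesSum
        (fun n => poch (μ - ν) n * polyGhat n (-ν) (-ν) (√((1 - x) / (1 + x)) : ℝ) /
            ((√Real.pi : ℝ) * 2 ^ (ν - μ) * (x : ℂ) ^ ν) *
          legendreP ν (-μ - n) x)
        ((((1 - x) / (1 + x) : ℝ) : ℂ) ^ ((μ - ν) / 4) *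
          (legendreP ν (-((μ + ν) / 2)) (1 / x) / Complex.Gamma ((μ - ν + 1) / 2)))) ∧
    MutuallyInverse
      (fun s n => poch (s - ν) n * polyGhat n ν ν (√((1 - x) / (1 + x)) : ℝ) / 2 ^ n)
      (fun s n => poch (s - ν) n * polyGhat n (-ν) (-ν) (√((1 - x) / (1 + x)) : ℝ) / 2 ^ n) := by
  have hr : 0 < (1 - x) / (1 + x) := div_pos (by linarith) (by linarith)
  have hr1 : (1 - x) / (1 + x) < 1 := by rw [div_lt_one (by linarith)]; linarith
  have hx : (x : ℂ) ≠ 0 := by exact_mod_cast hx0.ne'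
  have hd : ∀ a : ℂ, (x : ℂ) ^ a ≠ 0 := fun a => by simp [Complex.cpow_eq_zero_iff, hx]
  have hdd : (x : ℂ) ^ (-ν) * (x : ℂ) ^ ν = 1 := by
    rw [← Complex.cpow_add _ _ hx, neg_add_cancel, Complex.cpow_zero]
  have hP := fun m => legendreP_of_lt_one ν m hx0 hx1
  have hP' := fun m => legendreP_one_div ν m hx0 hx1
  generalize (1 - x) / (1 + x) = r at *
  have hw : ((√r : ℝ) : ℂ) ≠ 0 := by exact_mod_cast (Real.sqrt_pos.mpr hr).ne'
  have hw2 : ((√r : ℝ) : ℂ) ^ 2 = r := by exact_mod_cast Real.sq_sqrt hr.le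
  have hq : ‖(r : ℂ)‖ < 1 := by rwa [Complex.norm_real, Real.norm_of_nonneg hr.le]
  have hq' : ‖-(r : ℂ)‖ < 1 := by rwa [norm_neg]
  have hG : ∀ τ n, polyG n τ τ (√r : ℝ) * ((√r : ℝ) : ℂ) ^ n = scaledG n τ r := fun τ n => by
    rw [polyG_mul_pow n τ hw, hw2]
  have hG' : ∀ τ n, polyGhat n τ τ (√r : ℝ) * ((√r : ℝ) : ℂ) ^ n = scaledG n τ (-r) :=
    fun τ n => by rw [polyGhat_mul_pow n τ hw, hw2]
  have hPn : ∀ m, legendreP ν m x = 2 ^ (-ν) * ((1 + x : ℝ) : ℂ) ^ ν * (x : ℂ) ^ (-ν) *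
      (x : ℂ) ^ ν * (r : ℂ) ^ (-m / 2) * regF (-ν) (-m - ν) (1 - m) (-r) := fun m => by
    rw [hP, mul_assoc _ ((x : ℂ) ^ (-ν)), hdd, mul_one]
  have hPn' : ∀ m, legendreP ν m (1 / x) = 2 ^ (-ν) * ((1 + x : ℝ) : ℂ) ^ ν * (x : ℂ) ^ (-ν) *
      (r : ℂ) ^ (-m / 2) * regF (-ν) (-m - ν) (1 - m) (- -(r : ℂ)) := fun m => by
    rw [hP', neg_neg]
  exact ⟨seriesSum_pair_direct (L := fun m => legendreP ν m x)
      (L' := fun m => legendreP ν m (1 / x)) hr hq (hd _) (hG ν) hP hP',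
    fun h => seriesSum_pair_inverse (L := fun m => legendreP ν m x)
      (L' := fun m => legendreP ν m (1 / x)) hr hq (hd _) h (hG (-ν)) hP hP',
    mutuallyInverse_polyG ν _,
    seriesSum_pair_direct (L := fun m => legendreP ν m (1 / x))
      (L' := fun m => legendreP ν m x) hr hq' (hd _) (hG' ν) hPn' hPn,
    fun h => seriesSum_pair_inverse (L := fun m => legendreP ν m (1 / x))
      (L' := fun m => legendreP ν m x) hr hq' (hd _) h (hG' (-ν)) hPn' hPn,
    mutuallyInverse_polyGhat ν _⟩
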